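/- **Proposition 3.2 (Existence of closed geodesics).** Let $S\subset\mathbb{R}^3$ be a finite set of $k\ge 2$ points and let $Y=\mathbb{R}^3\setminus S$. Let $\phi:Y\to(0,\infty)$ be a harmonic function for which every point of $S$ is a genuine isolated singularity (that is, $\phi$ does not extend harmonically across any point of $S$). Let $(X,g)$ be a connected (hyperkähler) Riemannian 4-manifold obtained from $\phi$ by the Gibbons–Hawking ansatz, that is: $U(1)$ acts smoothly and isometrically on $X$, freely on an open dense set $\hat X$ consisting of all points with trivial stabilizer; there is a smooth map $\mu=(\mu_1,\mu_2,\mu_3):X\to\mathbb{R}^3$ with $\hat X=\mu^{-1}(Y)$ which restricts to a principal $U(1)$-bundle $\hat X\to Y$; and on $\hat X$ $$g=\frac1\phi\,\eta^2+\phi\,(d\mu_1^2+d\mu_2^2+d\mu_3^2),\qquad d\eta=-*d\phi,$$ where $\xi$ is the generator of the action, $\eta$ is the connection 1-form with $\eta(\xi)=1$ and $\ker\eta=\xi^{\perp}$, $*$ is the Euclidean Hodge star on $Y\subset\mathbb{R}^3$, and $\phi$ and $*d\phi$ are pulled back by $\mu$. Then there are closed geodesics in $X$, i.e. there is a non-constant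 periodic geodesic $\gamma:\mathbb{R}\to X$; moreover $\gamma$ can be taken to be an orbit $t\mapsto e^{it}\cdot x$ of the circle action, with $x\in\hat X$. -/

import Mathlib

open Set Filter Topology InnerProductSpace
open scoped Manifold ContDiff

-- Normed spaces carry the charted space structure given by the identity chart.
attribute [local instance 2000] chartedSpaceSelf

/-- Euclidean three-space, the target of the hyperkähler moment map. -/
abbrev R3 : Type := EuclideanSpace ℝ (Fin 3)

/-- The model space of four-dimensional manifolds. -/
abbrev R4 : Type := EuclideanSpace ℝ (Fin 4)

/-- A smooth Riemannian metric on a four-dimensional manifold `X`. -/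
abbrev Metric4 (X : Type*) [TopologicalSpace X] [ChartedSpace R4 X] [IsManifold (𝓡 4) ∞ X] :
    Type _ :=
  Bundle.ContMDiffRiemannianMetric (𝓡 4) ∞ R4 (fun x : X => TangentSpace (𝓡 4) x)

section Geodesics

variable {X : Type*} [TopologicalSpace X] [ChartedSpace R4 X] [IsManifold (𝓡 4) ∞ X]

/-- The coordinate tangent vector `v` at the coordinate point `y` of the preferred chart around
`x₀`, as a tangent vector of `X`. -/
noncomputable def coordVec (x₀ : X) (y v : R4) :
    TangentSpace (𝓡 4) ((extChartAt (𝓡 4) x₀).symm y) :=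
  mfderiv 𝓘(ℝ, R4) (𝓡 4) (extChartAt (𝓡 4) x₀).symm y v

/-- The metric tensor in the preferred chart around `x₀`: `g_y(u, v) = ∑ gᵢⱼ(y) uⁱ vʲ`. -/
noncomputable def coordMetric (g : Metric4 X) (x₀ : X) (y u v : R4) : ℝ :=
  g.inner ((extChartAt (𝓡 4) x₀).symm y) (coordVec x₀ y u) (coordVec x₀ y v)

/-- The Christoffel symbols of the first kind of the Levi-Civita connection in the preferred chart
around `x₀`, as a trilinear form:
`Γ(u, w; v) = ½ (∂_u g(w, v) + ∂_w g(u, v) - ∂_v g(u, w))`. -/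
noncomputable def coordChristoffel (g : Metric4 X) (x₀ : X) (y u w v : R4) : ℝ :=
  (1 / 2) * (fderiv ℝ (fun z => coordMetric g x₀ z w v) y u
    + fderiv ℝ (fun z => coordMetric g x₀ z u v) y w
    - fderiv ℝ (fun z => coordMetric g x₀ z u w) y v)

/-- A smooth curve `γ : ℝ → X` is a geodesic if `∇_{γ'} γ' = 0` for the Levi-Civita connection,
i.e. in every preferred chart it solves
`g(γ'', v) + Γ(γ', γ'; v) = 0` for all `v`
(the geodesic equation `γ''ᵏ + Γᵏᵢⱼ γ'ⁱ γ'ʲ = 0`, with the index `k` lowered). -/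
def IsGeodesic (g : Metric4 X) (γ : ℝ → X) : Prop :=
  ContMDiff 𝓘(ℝ, ℝ) (𝓡 4) ∞ γ ∧
  ∀ (x₀ : X) (t : ℝ), γ t ∈ (extChartAt (𝓡 4) x₀).source →
    let c : ℝ → R4 := fun s => extChartAt (𝓡 4) x₀ (γ s)
    ∀ v : R4,
      coordMetric g x₀ (c t) (deriv (deriv c) t) v
        + coordChristoffel g x₀ (c t) (deriv c t) (deriv c t) v = 0

/-- A closed geodesic: a geodesic `γ : ℝ → X` which is periodic and not constant. -/
def IsClosedGeodesic (g : Metric4 X) (γ : ℝ → X) : Prop :=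
  IsGeodesic g γ ∧ (∃ T : ℝ, 0 < T ∧ Function.Periodic γ T) ∧ ∃ t : ℝ, γ t ≠ γ 0

end Geodesics

section GibbonsHawking

/-- `φ` has an isolated singularity at `p`: it is harmonic on a punctured neighbourhood of `p`, and
the singularity is genuine, i.e. `φ` does not extend to a harmonic function near `p`. -/
def HasIsolatedSingularityAt (φ : R3 → ℝ) (p : R3) : Prop :=
  (∀ᶠ x in 𝓝[≠] p, HarmonicAt φ x) ∧ ¬ ∃ h : R3 → ℝ, HarmonicAt h p ∧ h =ᶠ[𝓝[≠] p] φ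

/-- The Hodge star of a 1-form on oriented Euclidean three-space: `(⋆α)(a, b) = α(a × b)`, so that
`⋆dx¹ = dx² ∧ dx³` and cyclically. -/
noncomputable def hodgeStar (α : R3 →L[ℝ] ℝ) (a b : R3) : ℝ :=
  α (WithLp.toLp 2 (crossProduct a.ofLp b.ofLp))

/-- The set `X̂` of points of `X` where the circle action is free. -/
def freeLocus (X : Type*) [MulAction Circle X] : Set X :=
  {x | ∀ z : Circle, z • x = x → z = 1}

variable {X : Type*} [TopologicalSpace X] [ChartedSpace R4 X] [IsManifold (𝓡 4) ∞ X]
  [MulAction Circle X]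

/-- The infinitesimal generator `ξ` of the circle action, `ξ(x) = d/dt|₀ (e^{it} • x)`. -/
noncomputable def circleGenerator (x : X) : TangentSpace (𝓡 4) x :=
  (mfderiv 𝓘(ℝ, ℝ) (𝓡 4) (fun t : ℝ => Circle.exp t • x) 0 (1 : ℝ) : R4)

/-- The connection 1-form `η` on `X̂`: the 1-form with `η(ξ) = 1` whose kernel is the
`g`-orthogonal complement of `ξ`. -/
noncomputable def connForm (g : Metric4 X) (x : X) (v : TangentSpace (𝓡 4) x) : ℝ :=
  g.inner x (circleGenerator x) v / g.inner x (circleGenerator x) (circleGenerator x)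

/-- The exterior derivative `dη(u, v) = ∂_u (η(v)) - ∂_v (η(u))` of the connection form, in the
preferred chart around `x₀`, at the coordinate point `y`, on coordinate vectors `u`, `v`. -/
noncomputable def coordCurvature (g : Metric4 X) (x₀ : X) (y u v : R4) : ℝ :=
  fderiv ℝ (fun z => connForm g ((extChartAt (𝓡 4) x₀).symm z) (coordVec x₀ z v)) y u
    - fderiv ℝ (fun z => connForm g ((extChartAt (𝓡 4) x₀).symm z) (coordVec x₀ z u)) y v

/-- The differential of `μ : X → ℝ³`. -/
noncomputable def momentDeriv (μ : X → R3) (x : X) (v : TangentSpace (𝓡 4) x) : R3 :=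
  mfderiv (𝓡 4) 𝓘(ℝ, R3) μ x v

/-- The Riemannian four-manifold `(X, g)` with its circle action is obtained from the
Gibbons–Hawking ansatz with moment map `μ = (μ₁, μ₂, μ₃) : X → ℝ³` and positive harmonic function
`φ` on the open set `Y ⊆ ℝ³`. The circle acts smoothly and by isometries; `μ` restricts to a
principal circle bundle `X̂ → Y` on the open dense free locus `X̂`; and on `X̂`
`g = φ⁻¹ η² + φ (dμ₁² + dμ₂² + dμ₃²)`, `dη = - ⋆ dφ`,
where `η` is the connection form. (The metric is then hyperkähler, with Kähler forms
`ωᵢ = η ∧ dμᵢ + φ dμⱼ ∧ dμₖ`, `(i, j, k)` cyclic.) -/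
structure IsGibbonsHawking (g : Metric4 X) (μ : X → R3) (φ : R3 → ℝ) (Y : Set R3) : Prop where
  isOpen_base : IsOpen Y
  harmonic : HarmonicOnNhd φ Y
  pos : ∀ q ∈ Y, 0 < φ q
  smooth_action : ContMDiff ((𝓡 1).prod (𝓡 4)) (𝓡 4) ∞ (fun p : Circle × X => p.1 • p.2)
  isometric_action : ∀ (z : Circle) (x : X) (u v : TangentSpace (𝓡 4) x),
    g.inner (z • x) (mfderiv (𝓡 4) (𝓡 4) (fun y : X => z • y) x u)
      (mfderiv (𝓡 4) (𝓡 4) (fun y : X => z • y) x v) = g.inner x u v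
  isOpen_free : IsOpen (freeLocus X)
  dense_free : Dense (freeLocus X)
  smooth_moment : ContMDiff (𝓡 4) 𝓘(ℝ, R3) ∞ μ
  /-- the points where the action is not free are those lying over the complement of `Y` -/
  free_iff : ∀ x : X, x ∈ freeLocus X ↔ μ x ∈ Y
  /-- the restriction of `μ` to `X̂` is onto `Y` ... -/
  surj : ∀ q ∈ Y, ∃ x : X, μ x = q
  /-- ... and its fibres are the circle orbits -/
  fibre_iff : ∀ x ∈ freeLocus X, ∀ y ∈ freeLocus X, μ x = μ y ↔ ∃ z : Circle, z • x = y
  metric_eq : ∀ x ∈ freeLocus X, ∀ u v : TangentSpace (𝓡 4) x,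
    g.inner x u v = (φ (μ x))⁻¹ * (connForm g x u * connForm g x v)
      + φ (μ x) * inner ℝ (momentDeriv μ x u) (momentDeriv μ x v)
  monopole : ∀ (x₀ : X), ∀ y ∈ (extChartAt (𝓡 4) x₀).target,
    (extChartAt (𝓡 4) x₀).symm y ∈ freeLocus X → ∀ u v : R4,
      coordCurvature g x₀ y u v
        = - hodgeStar (fderiv ℝ φ (μ ((extChartAt (𝓡 4) x₀).symm y)))
            (momentDeriv μ _ (coordVec x₀ y u)) (momentDeriv μ _ (coordVec x₀ y v))

end GibbonsHawking

/-! The circle orbit over q ∈ Y has length 2π/√φ(q), which suggests that the orbits over critical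
points of φ are geodesics. The theorem thus splits into an analytic half, the existence of a
critical point of φ, and a geometric half, the geodesic equation.

Analytic half (`exists_fderiv_eq_zero_of_isolatedSingularities`). Near each p ∈ S the positive
function φ is m_p/|x - p| plus a harmonic function, by Bôcher's theorem (`bocher`), and m_p > 0
because the singularity is genuine. Subtracting all poles leaves an entire harmonic function bounded
below, hence a constant by Liouville. So φ = c + V with V = ∑ m_p/|x - p|
(`exists_eq_const_add_sum_inv_dist`). The function 1/V, set to 0 on S, is continuous, nonnegative,
proper and vanishes exactly on S. As S has two points, a mountain pass argument
(`exists_fderiv_eq_zero_of_two_zeros`) yields a critical point off S, which is critical for V and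
for φ.

The potential theory rests on one explicit C² averaging kernel, which is minus the Laplacian of a
regularised 1/|x|. It gives the mean value property even for weakly harmonic functions, and from
that Harnack's inequality, Liouville's theorem and removability of bounded singularities.

Geometric half (`IsGibbonsHawking.isGeodesic_orbit`). Along the orbit over a critical point, φ and
1/φ have zero differential and dη = -⋆dφ vanishes. With η(ξ) = 1 and dμ(ξ) = 0 constant along the
orbit, all terms of the geodesic equation cancel (`geodesic_equation_of_fibration`). -/

/-! ### Partial derivatives, the Laplacian of radial functions, harmonicity of 1/|x - p|. -/

section LaplacianCalculus

/-- The partial derivative of `f` in the `i`-th coordinate direction of `ℝ³`. -/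
noncomputable def pderiv (i : Fin 3) (f : R3 → ℝ) (x : R3) : ℝ :=
  fderiv ℝ f x (EuclideanSpace.single i 1)

theorem pderiv_congr {i : Fin 3} {f g : R3 → ℝ} {x : R3} (h : f =ᶠ[𝓝 x] g) :
    pderiv i f x = pderiv i g x := by
  simp only [pderiv, h.fderiv_eq]

theorem ContDiffAt.pderiv {i : Fin 3} {f : R3 → ℝ} {x : R3} {n m : WithTop ℕ∞}
    (h : ContDiffAt ℝ n f x) (hmn : m + 1 ≤ n) : ContDiffAt ℝ m (pderiv i f) x :=
  (h.fderiv_right hmn).clm_apply contDiffAt_const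

theorem ContDiffAt.eventually_two {f : R3 → ℝ} {x : R3} (h : ContDiffAt ℝ 2 f x) :
    ∀ᶠ y in 𝓝 x, ContDiffAt ℝ 2 f y := h.eventually (by simp)

theorem laplacian_eq_sum_pderiv {f : R3 → ℝ} {x : R3} (h : ContDiffAt ℝ 2 f x) :
    Laplacian.laplacian f x = ∑ i, pderiv i (pderiv i f) x := by
  rw [laplacian_eq_iteratedFDeriv_orthonormalBasis f (EuclideanSpace.basisFun (Fin 3) ℝ)]
  refine Finset.sum_congr rfl fun i _ => ?_
  have hd : DifferentiableAt ℝ (fderiv ℝ f) x :=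
    (h.fderiv_right (m := 1) (by norm_num)).differentiableAt (by norm_num)
  have e : fderiv ℝ (pderiv i f) x
      = (fderiv ℝ (fderiv ℝ f) x).flip (EuclideanSpace.single i 1) := by
    have := (hd.hasFDerivAt.clm_apply
      (hasFDerivAt_const (EuclideanSpace.single i (1 : ℝ) : R3) x)).fderiv
    unfold _root_.pderiv
    rw [this]
    ext v
    simp
  rw [iteratedFDeriv_two_apply]
  simp [_root_.pderiv.eq_1 i (_root_.pderiv i f), e]

theorem pderiv_mul {i : Fin 3} {f g : R3 → ℝ} {x : R3} (hf : DifferentiableAt ℝ f x)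
    (hg : DifferentiableAt ℝ g x) :
    pderiv i (fun y => f y * g y) x = f x * pderiv i g x + g x * pderiv i f x := by
  simp only [pderiv]
  rw [fderiv_fun_mul hf hg]
  simp

theorem pderiv_add {i : Fin 3} {f g : R3 → ℝ} {x : R3} (hf : DifferentiableAt ℝ f x)
    (hg : DifferentiableAt ℝ g x) :
    pderiv i (fun y => f y + g y) x = pderiv i f x + pderiv i g x := by
  simp only [pderiv]
  rw [fderiv_fun_add hf hg]
  simp

theorem ContDiffAt.differentiableAt_two {f : R3 → ℝ} {x : R3} (h : ContDiffAt ℝ 2 f x) :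
    DifferentiableAt ℝ f x := h.differentiableAt (by norm_num)

theorem ContDiffAt.differentiableAt_pderiv {i : Fin 3} {f : R3 → ℝ} {x : R3}
    (h : ContDiffAt ℝ 2 f x) : DifferentiableAt ℝ (_root_.pderiv i f) x :=
  (h.pderiv (m := 1) (by norm_num)).differentiableAt (by norm_num)

theorem laplacian_mul {f g : R3 → ℝ} {x : R3} (hf : ContDiffAt ℝ 2 f x)
    (hg : ContDiffAt ℝ 2 g x) :
    Laplacian.laplacian (fun y => f y * g y) x = f x * Laplacian.laplacian g x
      + g x * Laplacian.laplacian f x + 2 * ∑ i, pderiv i f x * pderiv i g x := by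
  rw [laplacian_eq_sum_pderiv (hf.mul hg), laplacian_eq_sum_pderiv hf, laplacian_eq_sum_pderiv hg]
  simp only [Finset.mul_sum, ← Finset.sum_add_distrib]
  refine Finset.sum_congr rfl fun i _ => ?_
  have e : pderiv i (fun y => f y * g y) =ᶠ[𝓝 x]
      fun y => f y * pderiv i g y + g y * pderiv i f y := by
    filter_upwards [hf.eventually_two, hg.eventually_two] with y h1 h2
    exact pderiv_mul h1.differentiableAt_two h2.differentiableAt_two
  have df := hf.differentiableAt_two
  have dg := hg.differentiableAt_two
  have dpf := hf.differentiableAt_pderiv (i := i)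
  have dpg := hg.differentiableAt_pderiv (i := i)
  rw [pderiv_congr e, pderiv_add (f := fun y => f y * pderiv i g y)
    (g := fun y => g y * pderiv i f y) (df.mul dpg) (dg.mul dpf), pderiv_mul df dpg,
    pderiv_mul dg dpf]
  ring

theorem hasFDerivAt_normSq_sub (p x : R3) :
    HasFDerivAt (fun y : R3 => ‖y - p‖ ^ 2) (2 • innerSL ℝ (x - p)) x := by
  simpa using ((hasFDerivAt_id x).sub_const p).norm_sq

theorem contDiff_normSq_sub (p : R3) {n : WithTop ℕ∞} :
    ContDiff ℝ n (fun y : R3 => ‖y - p‖ ^ 2) := (contDiff_id.sub contDiff_const).norm_sq ℝ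

theorem pderiv_coord {i : Fin 3} (p x : R3) : pderiv i (fun y => (y - p) i) x = 1 := by
  have : HasFDerivAt (fun y : R3 => (y - p) i) (EuclideanSpace.proj i : R3 →L[ℝ] ℝ) x := by
    have := ((EuclideanSpace.proj i : R3 →L[ℝ] ℝ).hasFDerivAt (x := x)).sub_const (p i)
    simpa using this
  rw [pderiv, this.fderiv]
  simp

theorem pderiv_radial {i : Fin 3} {H : ℝ → ℝ} {H' : ℝ} {p x : R3}
    (h : HasDerivAt H H' (‖x - p‖ ^ 2)) :
    pderiv i (fun y => H (‖y - p‖ ^ 2)) x = 2 * H' * (x - p) i := by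
  have := (h.comp_hasFDerivAt x (hasFDerivAt_normSq_sub p x)).fderiv
  simp only [pderiv]
  rw [show (fun y => H (‖y - p‖ ^ 2)) = H ∘ (fun y : R3 => ‖y - p‖ ^ 2) from rfl, this]
  simp [EuclideanSpace.inner_single_right]
  ring

/-- With s = ‖x - p‖², each ∂ᵢ² contributes 4 H'' (x - p)ᵢ² + 2 H'; summing over the three
coordinates produces the 6. -/
theorem laplacian_radial {H H' : ℝ → ℝ} {H'' : ℝ} {p x : R3}
    (h : ContDiffAt ℝ 2 H (‖x - p‖ ^ 2)) (h1 : ∀ᶠ s in 𝓝 (‖x - p‖ ^ 2), HasDerivAt H (H' s) s)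
    (h2 : HasDerivAt H' H'' (‖x - p‖ ^ 2)) :
    Laplacian.laplacian (fun y => H (‖y - p‖ ^ 2)) x
      = 4 * ‖x - p‖ ^ 2 * H'' + 6 * H' (‖x - p‖ ^ 2) := by
  have hN : ContDiffAt ℝ 2 (fun y : R3 => ‖y - p‖ ^ 2) x := (contDiff_normSq_sub p).contDiffAt
  have key : ∀ i, pderiv i (pderiv i (fun y => H (‖y - p‖ ^ 2))) x
      = 4 * H'' * (x - p) i ^ 2 + 2 * H' (‖x - p‖ ^ 2) := by
    intro i
    have e : pderiv i (fun y => H (‖y - p‖ ^ 2)) =ᶠ[𝓝 x]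
        fun y => (2 * H' (‖y - p‖ ^ 2)) * (y - p) i := by
      filter_upwards [hN.continuousAt.eventually h1] with y hy using pderiv_radial hy
    have hH : DifferentiableAt ℝ (fun y => 2 * H' (‖y - p‖ ^ 2)) x :=
      (HasDerivAt.comp_hasFDerivAt (h₂ := fun s => 2 * H' s) x (h2.const_mul 2)
        (hasFDerivAt_normSq_sub p x)).differentiableAt
    have hc : DifferentiableAt ℝ (fun y : R3 => (y - p) i) x := by fun_prop
    rw [pderiv_congr e, pderiv_mul hH hc, pderiv_coord,
      pderiv_radial (H := fun s => 2 * H' s) (h2.const_mul 2)]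
    ring
  have hsq : ‖x - p‖ ^ 2 = ∑ i, (x - p) i ^ 2 := by
    simp only [EuclideanSpace.norm_sq_eq, Real.norm_eq_abs, sq_abs]
  rw [laplacian_eq_sum_pderiv (f := fun y => H (‖y - p‖ ^ 2)) (h.comp x hN)]
  rw [Finset.sum_congr rfl fun i _ => key i, Finset.sum_add_distrib, ← Finset.mul_sum, ← hsq]
  simp
  ring

theorem contDiffAt_inv_dist {p x : R3} (hx : x ≠ p) {n : WithTop ℕ∞} :
    ContDiffAt ℝ n (fun y : R3 => ‖y - p‖⁻¹) x :=
  ((contDiffAt_id.sub contDiffAt_const).norm ℝ (sub_ne_zero.2 hx)).inv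
    (norm_ne_zero_iff.2 (sub_ne_zero.2 hx))

theorem inv_norm_eq_rpow (y : R3) : ‖y‖⁻¹ = (‖y‖ ^ 2) ^ (-(1 / 2) : ℝ) := by
  rw [← Real.rpow_natCast, ← Real.rpow_mul (norm_nonneg _)]
  norm_num
  rw [Real.rpow_neg_one]

theorem hasDerivAt_rpow_of_pos {s : ℝ} (hs : 0 < s) (a : ℝ) :
    HasDerivAt (fun s : ℝ => s ^ a) (a * s ^ (a - 1)) s :=
  Real.hasDerivAt_rpow_const (Or.inl hs.ne')

theorem harmonicAt_inv_dist {p x : R3} (hx : x ≠ p) : HarmonicAt (fun y : R3 => ‖y - p‖⁻¹) x := by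
  refine ⟨contDiffAt_inv_dist hx, ?_⟩
  filter_upwards [isOpen_ne.mem_nhds hx] with y hy
  have hs : 0 < ‖y - p‖ ^ 2 := by have := norm_pos_iff.2 (sub_ne_zero.2 hy); positivity
  have e : (fun y : R3 => ‖y - p‖⁻¹)
      = fun y => (fun s : ℝ => s ^ (-(1 / 2) : ℝ)) (‖y - p‖ ^ 2) := by
    ext y; exact inv_norm_eq_rpow _
  have d1 : ∀ᶠ s in 𝓝 (‖y - p‖ ^ 2), HasDerivAt (fun s : ℝ => s ^ (-(1 / 2) : ℝ))
      ((-(1 / 2)) * s ^ (-(1 / 2) - 1 : ℝ)) s := by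
    filter_upwards [lt_mem_nhds hs] with s hs using hasDerivAt_rpow_of_pos hs _
  rw [e, laplacian_radial (Real.contDiffAt_rpow_const_of_ne hs.ne') d1
    ((hasDerivAt_rpow_of_pos hs _).const_mul _)]
  -- For H = s^(-1/2), the term 4s · (3/4) s^(-5/2) cancels 6 · (-1/2) s^(-3/2) once s^(-3/2) is
  -- written as s · s^(-5/2).
  have : (‖y - p‖ ^ 2) ^ (-(1 / 2) - 1 : ℝ)
      = ‖y - p‖ ^ 2 * (‖y - p‖ ^ 2) ^ (-(1 / 2) - 1 - 1 : ℝ) := by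
    nth_rewrite 2 [← Real.rpow_one (‖y - p‖ ^ 2)]
    rw [← Real.rpow_add hs]; norm_num
  simp only [Pi.zero_apply]
  rw [this]
  ring

end LaplacianCalculus

/-! ### Weak maximum principle and comparison on spherical shells. -/

section MaximumPrinciple

/-- If f'' were positive, the second derivative test would make x a local minimum too, so f would be
locally constant and f'' would vanish. -/
theorem IsLocalMax.deriv_deriv_nonpos {f : ℝ → ℝ} {x : ℝ} (h : IsLocalMax f x)
    (hc : ContinuousAt f x) : deriv (deriv f) x ≤ 0 := by
  by_contra! hp
  have hmin := isLocalMin_of_deriv_deriv_pos hp h.deriv_eq_zero hc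
  have e : f =ᶠ[𝓝 x] fun _ => f x := by
    filter_upwards [h, hmin] with y h1 h2 using le_antisymm h1 h2
  have e2 : deriv f =ᶠ[𝓝 x] fun _ => 0 := by
    filter_upwards [e.eventuallyEq_nhds] with y hy
    rw [hy.deriv_eq]; simp
  rw [e2.deriv_eq] at hp
  simp at hp

theorem IsLocalMax.laplacian_nonpos {f : R3 → ℝ} {x : R3} (h : IsLocalMax f x)
    (hf : ContDiffAt ℝ 2 f x) : Laplacian.laplacian f x ≤ 0 := by
  rw [laplacian_eq_sum_pderiv hf]
  refine Finset.sum_nonpos fun i _ => ?_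
  let v : R3 := EuclideanSpace.single i 1
  have hl : ∀ t : ℝ, HasDerivAt (fun t : ℝ => x + t • v) v t := fun t => by
    simpa using ((hasDerivAt_id t).smul_const v).const_add x
  have hc : Tendsto (fun t : ℝ => x + t • v) (𝓝 0) (𝓝 x) := by
    have := (hl 0).continuousAt.tendsto; simpa using this
  have hd : ∀ᶠ t : ℝ in 𝓝 0,
      HasDerivAt (fun t : ℝ => f (x + t • v)) (pderiv i f (x + t • v)) t := by
    filter_upwards [hc.eventually hf.eventually_two] with t ht
    exact (ht.differentiableAt_two.hasFDerivAt).comp_hasDerivAt t (hl t)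
  have hdd :
      HasDerivAt (fun t : ℝ => pderiv i f (x + t • v)) (pderiv i (pderiv i f) x) (0 : ℝ) := by
    have h1 : HasFDerivAt (pderiv i f) (fderiv ℝ (pderiv i f) x) (x + (0 : ℝ) • v) := by
      simpa using hf.differentiableAt_pderiv.hasFDerivAt
    exact h1.comp_hasDerivAt (0 : ℝ) (hl 0)
  have hm : IsLocalMax (fun t : ℝ => f (x + t • v)) 0 := by
    have := hc.eventually h
    simpa [IsLocalMax, IsMaxFilter] using this
  have e : deriv (fun t : ℝ => f (x + t • v)) =ᶠ[𝓝 0] fun t : ℝ => pderiv i f (x + t • v) := by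
    filter_upwards [hd] with t ht using ht.deriv
  have := hm.deriv_deriv_nonpos hd.self_of_nhds.continuousAt
  rwa [e.deriv_eq, hdd.deriv] at this

theorem laplacian_const_mul_normSq (c : ℝ) (x : R3) :
    Laplacian.laplacian (fun y : R3 => c * ‖y‖ ^ 2) x = 6 * c := by
  have := laplacian_radial (p := 0) (x := x) (H := fun s => c * s) (H' := fun _ => c) (H'' := 0)
    (by fun_prop) (Eventually.of_forall fun s => by simpa using (hasDerivAt_id s).const_mul c)
    (hasDerivAt_const _ _)
  simpa using this

/-- The weak maximum principle. -/
theorem le_of_harmonicAt_of_le_frontier {K : Set R3} (hK : IsCompact K) {u : R3 → ℝ} {M : ℝ}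
    (hc : ContinuousOn u K) (hu : ∀ x ∈ interior K, HarmonicAt u x)
    (hM : ∀ x ∈ K, x ∉ interior K → u x ≤ M) : ∀ x ∈ K, u x ≤ M := by
  obtain ⟨R, hR⟩ := hK.isBounded.exists_norm_le
  intro x hx
  refine le_of_forall_pos_le_add fun ε hε => ?_
  -- The perturbation δ‖y‖² is at most ε on K and has Laplacian 6δ > 0, which excludes an interior
  -- maximum of u + δ‖y‖².
  set δ : ℝ := ε / (R ^ 2 + 1) with hδ
  have hδ0 : 0 < δ := by positivity
  let v : R3 → ℝ := fun y => u y + δ * ‖y‖ ^ 2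
  obtain ⟨z, hz, hmax⟩ := hK.exists_isMaxOn ⟨x, hx⟩
    (hc.add (by fun_prop : ContinuousOn (fun y : R3 => δ * ‖y‖ ^ 2) K))
  have hzR : δ * ‖z‖ ^ 2 ≤ ε := by
    have h1 : ‖z‖ ^ 2 ≤ R ^ 2 := pow_le_pow_left₀ (norm_nonneg _) (hR z hz) 2
    calc δ * ‖z‖ ^ 2 ≤ δ * (R ^ 2 + 1) := by gcongr; linarith
      _ = ε := by rw [hδ]; field_simp
  have hzi : z ∉ interior K := by
    intro hzi
    have hloc : IsLocalMax v z := by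
      filter_upwards [mem_interior_iff_mem_nhds.1 hzi] with y hy using hmax hy
    have hq : ContDiffAt ℝ 2 (fun y : R3 => δ * ‖y‖ ^ 2) z :=
      (contDiff_const.mul (contDiff_id.norm_sq ℝ)).contDiffAt
    have h2 := hloc.laplacian_nonpos ((hu z hzi).1.add hq)
    have h3 : Laplacian.laplacian v z = 0 + 6 * δ := by
      have := (hu z hzi).1.laplacian_add hq
      rw [(hu z hzi).2.self_of_nhds, laplacian_const_mul_normSq] at this
      exact this
    linarith
  have h4 : u x + δ * ‖x‖ ^ 2 ≤ u z + δ * ‖z‖ ^ 2 := hmax hx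
  have h5 := hM z hz hzi
  have h6 : 0 ≤ δ * ‖x‖ ^ 2 := by positivity
  linarith

theorem InnerProductSpace.HarmonicAt.sub_const_mul_inv_dist {u : R3 → ℝ} {x p : R3}
    (hu : HarmonicAt u x) (hx : x ≠ p)
    (a b : ℝ) : HarmonicAt (fun y => u y - (a * ‖y - p‖⁻¹ + b)) x :=
  hu.sub (((harmonicAt_inv_dist hx).const_smul (c := a)).add (harmonicAt_const b))

/-- Comparison with the fundamental solution on a spherical shell. -/
theorem le_of_harmonicAt_annulus {u : R3 → ℝ} {p : R3} {r R a b : ℝ} (hr : 0 < r)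
    (hu : ∀ x, r ≤ ‖x - p‖ → ‖x - p‖ ≤ R → HarmonicAt u x)
    (h1 : ∀ x, ‖x - p‖ = r → u x ≤ a * r⁻¹ + b) (h2 : ∀ x, ‖x - p‖ = R → u x ≤ a * R⁻¹ + b)
    {x : R3} (hx : r ≤ ‖x - p‖) (hx' : ‖x - p‖ ≤ R) : u x ≤ a * ‖x - p‖⁻¹ + b := by
  let K : Set R3 := {x | r ≤ ‖x - p‖ ∧ ‖x - p‖ ≤ R}
  have hcont : Continuous fun x : R3 => ‖x - p‖ := by fun_prop
  have hK : IsCompact K := by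
    refine (isCompact_closedBall p R).of_isClosed_subset ?_ fun x hx => by
      simpa [dist_eq_norm] using hx.2
    exact (isClosed_le continuous_const hcont).inter (isClosed_le hcont continuous_const)
  have hne : ∀ x ∈ K, x ≠ p := fun x hx h => by
    have := hx.1; rw [h] at this; simp at this; linarith
  have hh : ∀ x ∈ K, HarmonicAt (fun y => u y - (a * ‖y - p‖⁻¹ + b)) x := fun x hx =>
    (hu x hx.1 hx.2).sub_const_mul_inv_dist (hne x hx) a b
  have := le_of_harmonicAt_of_le_frontier hK (u := fun y => u y - (a * ‖y - p‖⁻¹ + b)) (M := 0)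
    (fun x hx => (hh x hx).1.continuousAt.continuousWithinAt)
    (fun x hx => hh x (interior_subset hx)) (fun x hx hxi => ?_) x ⟨hx, hx'⟩
  · linarith
  · have hor : ‖x - p‖ = r ∨ ‖x - p‖ = R := by
      by_contra! hcon
      refine hxi (mem_interior_iff_mem_nhds.2 ?_)
      have o1 := hcont.continuousAt.eventually (lt_mem_nhds (lt_of_le_of_ne hx.1 hcon.1.symm))
      have o2 := hcont.continuousAt.eventually (gt_mem_nhds (lt_of_le_of_ne hx.2 hcon.2))
      filter_upwards [o1, o2] with y h1 h2 using ⟨h1.le, h2.le⟩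
    rcases hor with h | h
    · have := h1 x h; rw [h]; linarith
    · have := h2 x h; rw [h]; linarith

end MaximumPrinciple

open MeasureTheory

/-! ### A C² averaging kernel obtained from a regularised fundamental solution. -/

section BallKernel

theorem HasDerivAt.ite_le {f g f' g' : ℝ → ℝ} {a : ℝ} (hf : ∀ x, x ≤ a → HasDerivAt f (f' x) x)
    (hg : ∀ x, a ≤ x → HasDerivAt g (g' x) x) (h : f a = g a) (h' : f' a = g' a) (x : ℝ) :
    HasDerivAt (fun s => if s ≤ a then f s else g s) (if x ≤ a then f' x else g' x) x := by
  rcases lt_trichotomy x a with hx | rfl | hx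
  · rw [if_pos hx.le]
    refine (hf x hx.le).congr_of_eventuallyEq ?_
    filter_upwards [gt_mem_nhds hx] with y hy using if_pos hy.le
  · rw [if_pos le_rfl]
    have h1 : HasDerivWithinAt (fun s => if s ≤ x then f s else g s) (f' x) (Iic x) x :=
      (hf x le_rfl).hasDerivWithinAt.congr (fun y hy => if_pos hy) (if_pos le_rfl)
    have h2 : HasDerivWithinAt (fun s => if s ≤ x then f s else g s) (f' x) (Ici x) x := by
      refine (h' ▸ (hg x le_rfl).hasDerivWithinAt).congr (fun y hy => ?_) (by simp [h])
      rcases eq_or_lt_of_le (show x ≤ y from hy) with rfl | hy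
      · simp [h]
      · exact if_neg (not_le.2 hy)
    simpa [Iic_union_Ici, hasDerivWithinAt_univ] using h1.union h2
  · rw [if_neg (not_le.2 hx)]
    refine (hg x hx.le).congr_of_eventuallyEq ?_
    filter_upwards [lt_mem_nhds hx] with y hy using if_neg (not_le.2 hy)

/-- A `C²` function on the line equal to `s ^ (-1/2)` for `s ≥ 1`; it regularises the fundamental
solution of the Laplacian, as a function of the square of the distance. -/
noncomputable def regProfile (s : ℝ) : ℝ :=
  if s ≤ 1 then 1 - 1 / 2 * (s - 1) + 3 / 8 * (s - 1) ^ 2 - 5 / 16 * (s - 1) ^ 3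
    + 35 / 128 * (s - 1) ^ 4 else s ^ (-(1 / 2) : ℝ)

noncomputable def regProfile' (s : ℝ) : ℝ :=
  if s ≤ 1 then -(1 / 2) + 3 / 4 * (s - 1) - 15 / 16 * (s - 1) ^ 2 + 35 / 32 * (s - 1) ^ 3
  else -(1 / 2) * s ^ (-(1 / 2) - 1 : ℝ)

noncomputable def regProfile'' (s : ℝ) : ℝ :=
  if s ≤ 1 then 3 / 4 - 15 / 8 * (s - 1) + 105 / 32 * (s - 1) ^ 2
  else -(1 / 2) * ((-(1 / 2) - 1) * s ^ (-(1 / 2) - 1 - 1 : ℝ))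

/-- The radial profile of the averaging kernel. -/
noncomputable def kernelProfile (s : ℝ) : ℝ := 315 / 16 * max 0 (1 - s) ^ 3

theorem hasDerivAt_regProfile (s : ℝ) : HasDerivAt regProfile (regProfile' s) s := by
  refine HasDerivAt.ite_le (f' := fun s => -(1 / 2) + 3 / 4 * (s - 1) - 15 / 16 * (s - 1) ^ 2
    + 35 / 32 * (s - 1) ^ 3) (g' := fun s => -(1 / 2) * s ^ (-(1 / 2) - 1 : ℝ)) ?_ ?_ ?_ ?_ s
  · intro x _
    have h := (hasDerivAt_id x).sub_const 1
    refine (((((h.const_mul (1 / 2)).const_sub 1).add ((h.pow 2).const_mul (3 / 8))).sub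
      ((h.pow 3).const_mul (5 / 16))).add ((h.pow 4).const_mul (35 / 128))).congr_deriv ?_
    simp only [id]; norm_num; ring
  · intro x hx
    exact hasDerivAt_rpow_of_pos (by linarith) _
  · norm_num
  · norm_num

theorem hasDerivAt_regProfile' (s : ℝ) : HasDerivAt regProfile' (regProfile'' s) s := by
  refine HasDerivAt.ite_le (f' := fun s => 3 / 4 - 15 / 8 * (s - 1) + 105 / 32 * (s - 1) ^ 2)
    (g' := fun s => -(1 / 2) * ((-(1 / 2) - 1) * s ^ (-(1 / 2) - 1 - 1 : ℝ))) ?_ ?_ ?_ ?_ s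
  · intro x _
    have h := (hasDerivAt_id x).sub_const 1
    refine ((((h.const_mul (3 / 4)).const_add (-(1 / 2))).sub ((h.pow 2).const_mul (15 / 16))).add
      ((h.pow 3).const_mul (35 / 32))).congr_deriv ?_
    simp only [id]; norm_num; ring
  · intro x hx
    exact (hasDerivAt_rpow_of_pos (by linarith) _).const_mul _
  · norm_num
  · norm_num

/-- The third derivatives of the two branches also match at s = 1, so `regProfile''` is even
differentiable. -/
theorem continuous_regProfile'' : Continuous regProfile'' := by
  refine continuous_iff_continuousAt.2 fun s => HasDerivAt.continuousAt <|
    HasDerivAt.ite_le (f' := fun s => -(15 / 8) + 105 / 16 * (s - 1))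
    (g' := fun s => -(1 / 2) * ((-(1 / 2) - 1) * ((-(1 / 2) - 1 - 1) *
      s ^ (-(1 / 2) - 1 - 1 - 1 : ℝ)))) ?_ ?_ ?_ ?_ s
  · intro x _
    have h := (hasDerivAt_id x).sub_const 1
    refine (((h.const_mul (15 / 8)).const_sub (3 / 4)).add
      ((h.pow 2).const_mul (105 / 32))).congr_deriv ?_
    simp only [id]; norm_num; ring
  · intro x hx
    exact ((hasDerivAt_rpow_of_pos (by linarith) _).const_mul _).const_mul _
  · norm_num
  · norm_num

theorem contDiff_regProfile : ContDiff ℝ 2 regProfile := by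
  have e1 : deriv regProfile = regProfile' := funext fun s => (hasDerivAt_regProfile s).deriv
  have e2 : deriv regProfile' = regProfile'' := funext fun s => (hasDerivAt_regProfile' s).deriv
  rw [show (2 : WithTop ℕ∞) = 1 + 1 by norm_num, contDiff_succ_iff_deriv]
  refine ⟨fun s => (hasDerivAt_regProfile s).differentiableAt, by simp, ?_⟩
  rw [e1, contDiff_one_iff_deriv, e2]
  exact ⟨fun s => (hasDerivAt_regProfile' s).differentiableAt, continuous_regProfile''⟩

/-- The polynomial branch of `regProfile` is the degree 4 Taylor polynomial of s^(-1/2) at 1. Since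
4s H'' + 6 H' kills s^(-1/2), only the cubic term caused by the truncation survives, with
coefficient (48 + 24) · 35/128 = 315/16. It has the sign that makes the kernel nonnegative. -/
theorem regProfile_ode {s : ℝ} : 4 * s * regProfile'' s + 6 * regProfile' s = -kernelProfile s := by
  unfold regProfile' regProfile'' kernelProfile
  split_ifs with h
  · rw [max_eq_right (by linarith)]; ring
  · have hs : 0 < s := by linarith
    rw [max_eq_left (by linarith)]
    have : s ^ (-(1 / 2) - 1 : ℝ) = s * s ^ (-(1 / 2) - 1 - 1 : ℝ) := by
      nth_rewrite 2 [← Real.rpow_one s]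
      rw [← Real.rpow_add hs]; norm_num
    rw [this]; ring

theorem hasDerivAt_max_pow (n : ℕ) (s : ℝ) : HasDerivAt (fun s : ℝ => max 0 (1 - s) ^ (n + 2))
    (-(n + 2) * max 0 (1 - s) ^ (n + 1)) s := by
  have e : ∀ k : ℕ, (fun s : ℝ => max 0 (1 - s) ^ (k + 1))
      = fun s => if s ≤ 1 then (1 - s) ^ (k + 1) else 0 := fun k => by
    ext s
    split_ifs with h
    · rw [max_eq_right (by linarith)]
    · rw [max_eq_left (by linarith)]; simp
  have e' : max 0 (1 - s) ^ (n + 1) = if s ≤ 1 then (1 - s) ^ (n + 1) else 0 := congrFun (e n) s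
  rw [e (n + 1), e', mul_ite, mul_zero]
  refine HasDerivAt.ite_le (f' := fun s => -(n + 2) * (1 - s) ^ (n + 1)) (g' := fun _ => 0)
    ?_ (fun x _ => hasDerivAt_const x _) (by simp) (by simp) s
  intro x _
  refine (((hasDerivAt_id x).const_sub 1).pow (n + 2)).congr_deriv ?_
  simp
  ring

theorem contDiff_kernelProfile : ContDiff ℝ 2 kernelProfile := by
  refine contDiff_const.mul ?_
  have e1 : deriv (fun s : ℝ => max 0 (1 - s) ^ 3) = fun s => -3 * max 0 (1 - s) ^ 2 :=
    funext fun s => by rw [(hasDerivAt_max_pow 1 s).deriv]; norm_num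
  have e2 : deriv (fun s : ℝ => max 0 (1 - s) ^ 2) = fun s => -2 * max 0 (1 - s) ^ 1 :=
    funext fun s => by rw [(hasDerivAt_max_pow 0 s).deriv]; norm_num
  rw [show (2 : WithTop ℕ∞) = 1 + 1 by norm_num, contDiff_succ_iff_deriv]
  refine ⟨fun s => (hasDerivAt_max_pow 1 s).differentiableAt, by simp, ?_⟩
  rw [e1]
  refine contDiff_const.mul ?_
  rw [contDiff_one_iff_deriv, e2]
  exact ⟨fun s => (hasDerivAt_max_pow 0 s).differentiableAt, by fun_prop⟩

theorem kernelProfile_nonneg (s : ℝ) : 0 ≤ kernelProfile s := by unfold kernelProfile; positivity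

theorem kernelProfile_of_one_le {s : ℝ} (hs : 1 ≤ s) : kernelProfile s = 0 := by
  unfold kernelProfile; rw [max_eq_left (by linarith)]; norm_num

/-- The radial averaging kernel at scale `t`, supported in the ball of radius `t`. -/
noncomputable def ballKernel (t : ℝ) (z : R3) : ℝ := (t⁻¹) ^ 3 * kernelProfile (‖z‖ ^ 2 * t⁻¹ ^ 2)

/-- The regularised fundamental solution at scale `t`. -/
noncomputable def regFundamental (t : ℝ) (z : R3) : ℝ := t⁻¹ * regProfile (‖z‖ ^ 2 * t⁻¹ ^ 2)

theorem contDiff_regFundamental (t : ℝ) : ContDiff ℝ 2 (regFundamental t) :=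
  contDiff_const.mul (contDiff_regProfile.comp ((contDiff_id.norm_sq ℝ).mul contDiff_const))

theorem contDiff_ballKernel (t : ℝ) : ContDiff ℝ 2 (ballKernel t) :=
  contDiff_const.mul (contDiff_kernelProfile.comp ((contDiff_id.norm_sq ℝ).mul contDiff_const))

theorem ballKernel_nonneg {t : ℝ} (ht : 0 < t) (z : R3) : 0 ≤ ballKernel t z :=
  mul_nonneg (by positivity) (kernelProfile_nonneg _)

theorem one_le_normSq_mul {t : ℝ} (ht : 0 < t) {z : R3} (hz : t ≤ ‖z‖) :
    1 ≤ ‖z‖ ^ 2 * t⁻¹ ^ 2 := by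
  rw [← mul_pow]
  refine one_le_pow₀ ?_
  rw [← div_eq_mul_inv, le_div_iff₀ ht]; linarith

theorem ballKernel_eq_zero {t : ℝ} (ht : 0 < t) {z : R3} (hz : t ≤ ‖z‖) : ballKernel t z = 0 := by
  rw [ballKernel, kernelProfile_of_one_le (one_le_normSq_mul ht hz), mul_zero]

theorem regFundamental_eq {t : ℝ} (ht : 0 < t) {z : R3} (hz : t ≤ ‖z‖) :
    regFundamental t z = ‖z‖⁻¹ := by
  have h1 := one_le_normSq_mul ht hz
  have hz0 : 0 < ‖z‖ := ht.trans_le hz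
  have e : regProfile (‖z‖ ^ 2 * t⁻¹ ^ 2) = (‖z‖ ^ 2 * t⁻¹ ^ 2) ^ (-(1 / 2) : ℝ) := by
    unfold regProfile
    split_ifs with h
    · have : ‖z‖ ^ 2 * t⁻¹ ^ 2 = 1 := le_antisymm h h1
      rw [this]; norm_num
    · rfl
  have e2 : ‖z‖ ^ 2 * t⁻¹ ^ 2 = ‖t⁻¹ • z‖ ^ 2 := by
    rw [norm_smul, mul_pow, Real.norm_eq_abs, sq_abs]; ring
  rw [regFundamental, e, e2, ← inv_norm_eq_rpow, norm_smul, Real.norm_eq_abs,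
    abs_of_pos (by positivity)]
  field_simp

theorem laplacian_regFundamental (t : ℝ) (p x : R3) :
    Laplacian.laplacian (fun y => regFundamental t (y - p)) x = - ballKernel t (x - p) := by
  have h1 : ∀ s : ℝ, HasDerivAt (fun s => t⁻¹ * regProfile (s * t⁻¹ ^ 2))
      (t⁻¹ ^ 3 * regProfile' (s * t⁻¹ ^ 2)) s := fun s => by
    have := ((hasDerivAt_regProfile (s * t⁻¹ ^ 2)).comp s
      ((hasDerivAt_id s).mul_const (t⁻¹ ^ 2))).const_mul t⁻¹
    refine this.congr_deriv ?_
    ring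
  have h2 : ∀ s : ℝ, HasDerivAt (fun s => t⁻¹ ^ 3 * regProfile' (s * t⁻¹ ^ 2))
      (t⁻¹ ^ 5 * regProfile'' (s * t⁻¹ ^ 2)) s := fun s => by
    have := ((hasDerivAt_regProfile' (s * t⁻¹ ^ 2)).comp s
      ((hasDerivAt_id s).mul_const (t⁻¹ ^ 2))).const_mul (t⁻¹ ^ 3)
    refine this.congr_deriv ?_
    ring
  have hC : ContDiff ℝ 2 (fun s => t⁻¹ * regProfile (s * t⁻¹ ^ 2)) :=
    contDiff_const.mul (contDiff_regProfile.comp (contDiff_id.mul contDiff_const))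
  have := laplacian_radial (p := p) (x := x) hC.contDiffAt (Eventually.of_forall h1) (h2 _)
  rw [show (fun y => regFundamental t (y - p))
    = fun y => t⁻¹ * regProfile (‖y - p‖ ^ 2 * t⁻¹ ^ 2) from rfl, this, ballKernel]
  linear_combination t⁻¹ ^ 3 * regProfile_ode (s := ‖x - p‖ ^ 2 * t⁻¹ ^ 2)

theorem ballKernel_scale {t : ℝ} (z : R3) : ballKernel t z = t⁻¹ ^ 3 * ballKernel 1 (t⁻¹ • z) := by
  simp only [ballKernel, norm_smul, mul_pow, Real.norm_eq_abs, sq_abs]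
  simp [mul_comm]

theorem integrable_ballKernel_one : Integrable (ballKernel 1) :=
  (contDiff_ballKernel 1).continuous.integrable_of_hasCompactSupport <|
    HasCompactSupport.of_support_subset_isCompact (isCompact_closedBall 0 1) fun z hz => by
      by_contra h
      exact hz (ballKernel_eq_zero one_pos (by simpa using (not_le.1 (by simpa using h)).le))

/-- The total mass of the averaging kernels. -/
noncomputable def kernelMass : ℝ := ∫ z, ballKernel 1 z

theorem kernelMass_pos : 0 < kernelMass := by
  refine (integral_pos_iff_support_of_nonneg (ballKernel_nonneg one_pos)
    integrable_ballKernel_one).2 ?_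
  refine (IsOpen.measure_pos volume (contDiff_ballKernel 1).continuous.isOpen_support ⟨0, ?_⟩)
  simp [ballKernel, kernelProfile]

end BallKernel

/-! ### Distributional harmonicity and the mean value property. -/

section WeaklyHarmonic

/-- `w` is harmonic on `U` in the sense of distributions. -/
def WeaklyHarmonicOn (w : R3 → ℝ) (U : Set R3) : Prop :=
  ∀ ψ : R3 → ℝ, ContDiff ℝ 2 ψ → HasCompactSupport ψ → tsupport ψ ⊆ U →
    ∫ y, w y * Laplacian.laplacian ψ y = 0

theorem integrable_mul_of_continuousOn {f g : R3 → ℝ} {U : Set R3} (hU : IsOpen U)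
    (hf : ContinuousOn f U) (hg : Continuous g) (hc : HasCompactSupport g) (hs : tsupport g ⊆ U) :
    Integrable fun y => f y * g y := by
  have hsub : tsupport (fun y => f y * g y) ⊆ tsupport g :=
    closure_mono fun y hy hy' => hy (by simp [hy'])
  refine Continuous.integrable_of_hasCompactSupport
    (continuous_of_tsupport fun y hy => ?_) (hc.of_isClosed_subset (isClosed_tsupport _) hsub)
  exact (hf.continuousAt (hU.mem_nhds (hs (hsub hy)))).mul hg.continuousAt

theorem tsupport_pderiv_subset (i : Fin 3) (f : R3 → ℝ) : tsupport (pderiv i f) ⊆ tsupport f :=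
  tsupport_fderiv_apply_subset ℝ _

theorem integral_mul_pderiv {f g : R3 → ℝ} {U : Set R3} (hU : IsOpen U) (i : Fin 3)
    (hf : ContDiffOn ℝ 1 f U) (hg : ContDiff ℝ 1 g) (hc : HasCompactSupport g)
    (hs : tsupport g ⊆ U) : ∫ y, f y * pderiv i g y = - ∫ y, pderiv i f y * g y := by
  have hpg : Continuous (pderiv i g) := by
    exact (contDiff_iff_contDiffAt.2 fun x => hg.contDiffAt.pderiv (m := 0) (by simp)).continuous
  have hpf : ContinuousOn (pderiv i f) U := fun x hx =>
    ((hf.contDiffAt (hU.mem_nhds hx)).pderiv (m := 0) (by simp)).continuousAt.continuousWithinAt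
  have hts := (tsupport_pderiv_subset i g)
  exact integral_mul_fderiv_eq_neg_fderiv_mul_of_integrable
    (integrable_mul_of_continuousOn hU hpf hg.continuous hc hs)
    (integrable_mul_of_continuousOn hU hf.continuousOn hpg
      (hc.of_isClosed_subset (isClosed_tsupport _) hts) (hts.trans hs))
    (integrable_mul_of_continuousOn hU hf.continuousOn hg.continuous hc hs)
    (fun x hx => (hf.contDiffAt (hU.mem_nhds (hs hx))).differentiableAt (by norm_num))
    (fun x _ => hg.differentiable (by norm_num) x)

theorem InnerProductSpace.HarmonicOnNhd.weaklyHarmonicOn {u : R3 → ℝ} {U : Set R3} (hU : IsOpen U)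
    (hu : HarmonicOnNhd u U) : WeaklyHarmonicOn u U := by
  intro ψ hψ hc hs
  have hp : ∀ i, ContDiff ℝ 1 (pderiv i ψ) := fun i =>
    contDiff_iff_contDiffAt.2 fun x => hψ.contDiffAt.pderiv (by norm_num)
  have hts := fun i => (tsupport_pderiv_subset i ψ)
  have hpc := fun i => hc.of_isClosed_subset (isClosed_tsupport _) (hts i)
  have hpu : ∀ i, ContDiffOn ℝ 1 (pderiv i u) U := fun i x hx =>
    ((hu x hx).1.pderiv (by norm_num)).contDiffWithinAt
  have hppψ : ∀ i, Continuous (pderiv i (pderiv i ψ)) := fun i =>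
    (contDiff_iff_contDiffAt.2 fun x => (hp i).contDiffAt.pderiv (m := 0) (by simp)).continuous
  have hppu : ∀ i, ContinuousOn (pderiv i (pderiv i u)) U := fun i x hx =>
    (((hpu i).contDiffAt (hU.mem_nhds hx)).pderiv (m := 0)
      (by simp)).continuousAt.continuousWithinAt
  have hu1 : ContDiffOn ℝ 1 u U := fun x hx => ((hu x hx).1.of_le (by norm_num)).contDiffWithinAt
  have key : ∀ i, ∫ y, u y * pderiv i (pderiv i ψ) y = ∫ y, pderiv i (pderiv i u) y * ψ y := by
    intro i
    rw [integral_mul_pderiv hU i hu1 (hp i) (hpc i) ((hts i).trans hs),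
      integral_mul_pderiv hU i (hpu i) (hψ.of_le (by norm_num)) hc hs, neg_neg]
  calc ∫ y, u y * Laplacian.laplacian ψ y
      = ∫ y, ∑ i, u y * pderiv i (pderiv i ψ) y := by
        refine integral_congr_ae (Eventually.of_forall fun y => ?_)
        simp only [laplacian_eq_sum_pderiv hψ.contDiffAt, Finset.mul_sum]
    _ = ∑ i, ∫ y, u y * pderiv i (pderiv i ψ) y := by
        refine integral_finsetSum _ fun i _ => integrable_mul_of_continuousOn hU hu1.continuousOn
          (hppψ i) ?_ ?_
        · exact (hpc i).of_isClosed_subset (isClosed_tsupport _) (tsupport_pderiv_subset _ _)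
        · exact (tsupport_pderiv_subset _ _).trans ((hts i).trans hs)
    _ = ∑ i, ∫ y, pderiv i (pderiv i u) y * ψ y := Finset.sum_congr rfl fun i _ => key i
    _ = ∫ y, ∑ i, pderiv i (pderiv i u) y * ψ y :=
        (integral_finsetSum _ fun i _ => integrable_mul_of_continuousOn hU (hppu i)
          hψ.continuous hc hs).symm
    _ = 0 := by
        refine integral_eq_zero_of_ae (Eventually.of_forall fun y => ?_)
        simp only [Pi.zero_apply, ← Finset.sum_mul]
        by_cases hy : y ∈ tsupport ψ
        · have h := hu y (hs hy)
          rw [← laplacian_eq_sum_pderiv h.1, h.2.self_of_nhds]; simp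
        · rw [image_eq_zero_of_notMem_tsupport hy, mul_zero]

theorem integrable_mul_of_integrableOn_closedBall {w g : R3 → ℝ} {p : R3} {T : ℝ}
    (hw : IntegrableOn w (Metric.closedBall p T)) (hg : Continuous g)
    (hs : ∀ y, T < ‖y - p‖ → g y = 0) : Integrable fun y => w y * g y := by
  have h1 : IntegrableOn (fun y => w y * g y) (Metric.closedBall p T) :=
    hw.mul_continuousOn hg.continuousOn (isCompact_closedBall p T)
  rw [integrableOn_iff_integrable_of_support_subset] at h1
  · exact h1
  · intro y hy
    by_contra h
    exact hy (by simp only; rw [hs y (by simpa [dist_eq_norm] using h), mul_zero])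

/-- Both regularised fundamental solutions equal 1/‖y - p‖ outside radius T, so their difference is
a C² test function supported in the closed ball; its Laplacian is the difference of the two kernels.
-/
theorem WeaklyHarmonicOn.integral_ballKernel_eq {w : R3 → ℝ} {U : Set R3}
    (hw : WeaklyHarmonicOn w U) {p : R3} {t T : ℝ} (ht : 0 < t) (htT : t ≤ T)
    (hU : Metric.closedBall p T ⊆ U) (hi : IntegrableOn w (Metric.closedBall p T)) :
    ∫ y, w y * ballKernel t (y - p) = ∫ y, w y * ballKernel T (y - p) := by
  have hT : 0 < T := ht.trans_le htT
  let ψ : R3 → ℝ := (fun y => regFundamental t (y - p)) - (fun y => regFundamental T (y - p))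
  have hr : ∀ t : ℝ, ContDiff ℝ 2 (fun y : R3 => regFundamental t (y - p)) := fun t =>
    (contDiff_regFundamental t).comp (contDiff_id.sub contDiff_const)
  have hsupp : Function.support ψ ⊆ Metric.closedBall p T := by
    intro y hy
    by_contra h
    have h : T < ‖y - p‖ := by simpa [dist_eq_norm] using h
    refine hy ?_
    simp only [ψ, Pi.sub_apply, regFundamental_eq ht (htT.trans h.le), regFundamental_eq hT h.le,
      sub_self]
  have hψ := hw ψ ((hr t).sub (hr T))
    (HasCompactSupport.of_support_subset_isCompact (isCompact_closedBall p T) hsupp)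
    ((closure_minimal hsupp Metric.isClosed_closedBall).trans hU)
  have hk : ∀ t, 0 < t → t ≤ T → Integrable fun y => w y * ballKernel t (y - p) := fun t ht htT =>
    integrable_mul_of_integrableOn_closedBall hi
      ((contDiff_ballKernel t).continuous.comp (continuous_id.sub continuous_const))
      fun y hy => ballKernel_eq_zero ht (htT.trans hy.le)
  have e : ∀ y, w y * Laplacian.laplacian ψ y
      = w y * ballKernel T (y - p) - w y * ballKernel t (y - p) := fun y => by
    have := (hr t).contDiffAt.laplacian_sub ((hr T).contDiffAt (x := y))
    rw [laplacian_regFundamental, laplacian_regFundamental] at this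
    rw [this]; ring
  simp only [e] at hψ
  rw [integral_sub (hk T hT le_rfl) (hk t ht htT)] at hψ
  linarith

/-- The mean value property. -/
theorem WeaklyHarmonicOn.integral_ballKernel {w : R3 → ℝ} {U : Set R3}
    (hw : WeaklyHarmonicOn w U) {p : R3} {T : ℝ} (hT : 0 < T)
    (hU : Metric.closedBall p T ⊆ U) (hi : IntegrableOn w (Metric.closedBall p T))
    (hc : ContinuousAt w p) : ∫ y, w y * ballKernel T (y - p) = kernelMass * w p := by
  have hA := kernelMass_pos
  let g : R3 → ℝ := (Metric.closedBall p T).indicator w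
  have hgc : ContinuousAt g p := hc.congr <| by
    filter_upwards [Metric.closedBall_mem_nhds p hT] with y hy using
      (indicator_of_mem hy w).symm
  have hgp : g p = w p := indicator_of_mem (Metric.mem_closedBall_self hT.le) w
  have hgi : Integrable g := hi.integrable_indicator Metric.isClosed_closedBall.measurableSet
  have hlim := tendsto_integral_comp_smul_smul_of_integrable' (μ := volume)
    (φ := fun z : R3 => kernelMass⁻¹ * ballKernel 1 z) (x₀ := p)
    (fun z => mul_nonneg (by positivity) (ballKernel_nonneg one_pos z))
    (by rw [integral_const_mul]; exact inv_mul_cancel₀ hA.ne')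
    (by
      refine tendsto_const_nhds.congr' ?_
      filter_upwards [(tendsto_norm_cobounded_atTop (E := R3)).eventually_ge_atTop 1] with z hz
      rw [ballKernel_eq_zero one_pos hz]; simp) hgi hgc
  rw [hgp] at hlim
  -- The average at scale c⁻¹ ≤ T does not depend on c, while the approximate identity makes it tend
  -- to w p as c → ∞.
  have hev : ∀ᶠ c : ℝ in atTop, ∫ y, (c ^ (Module.finrank ℝ R3) *
      (kernelMass⁻¹ * ballKernel 1 (c • (p - y)))) • g y
        = kernelMass⁻¹ * ∫ y, w y * ballKernel T (y - p) := by
    filter_upwards [eventually_ge_atTop (T⁻¹), eventually_gt_atTop 0] with c hc hc0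
    have hcT : c⁻¹ ≤ T := inv_le_of_inv_le₀ hT hc
    rw [← hw.integral_ballKernel_eq (inv_pos.2 hc0) hcT hU hi, ← integral_const_mul]
    refine integral_congr_ae (Eventually.of_forall fun y => ?_)
    simp only
    rw [ballKernel_scale (t := c⁻¹), inv_inv, finrank_euclideanSpace_fin]
    have e1 : ballKernel 1 (c • (p - y)) = ballKernel 1 (c • (y - p)) := by
      simp only [ballKernel, norm_smul, norm_sub_rev]
    rw [e1, smul_eq_mul]
    by_cases hy : y ∈ Metric.closedBall p T
    · simp only [g, indicator_of_mem hy]; ring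
    · have : T < ‖y - p‖ := by simpa [dist_eq_norm] using hy
      have h0 : ballKernel 1 (c • (y - p)) = 0 := by
        refine ballKernel_eq_zero one_pos ?_
        rw [norm_smul, Real.norm_eq_abs, abs_of_pos hc0]
        calc (1 : ℝ) = T⁻¹ * T := (inv_mul_cancel₀ hT.ne').symm
          _ ≤ c * ‖y - p‖ := by gcongr
      rw [h0]; ring
  have := tendsto_nhds_unique hlim (tendsto_const_nhds.congr' (EventuallyEq.symm hev))
  rw [this]; field_simp

end WeaklyHarmonic

/-! ### Harnack inequalities and Liouville's theorem. -/

section Harnack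

/-- On the small ball ‖v - x‖ ≤ T/2, so the large kernel's cubed factor is at least (3/4)³ = 27/64,
that of the small kernel is at most 1, and the change of scale costs 4³ = 64. Hence 64 · 64/27 =
4096/27. -/
theorem ballKernel_le {T : ℝ} (hT : 0 < T) {x y v : R3} (hxy : ‖x - y‖ ≤ T / 4) :
    ballKernel (T / 4) (v - y) ≤ 4096 / 27 * ballKernel T (v - x) := by
  rcases le_or_gt (T / 4) ‖v - y‖ with h | h
  · rw [ballKernel_eq_zero (by positivity) h]
    exact mul_nonneg (by norm_num) (ballKernel_nonneg hT _)
  · have h1 : ‖v - x‖ ≤ T / 2 := by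
      have := norm_sub_le_norm_sub_add_norm_sub v y x
      rw [norm_sub_rev y x] at this; linarith
    have h2 : ‖v - x‖ ^ 2 * T⁻¹ ^ 2 ≤ 1 / 4 := by
      calc ‖v - x‖ ^ 2 * T⁻¹ ^ 2 ≤ (T / 2) ^ 2 * T⁻¹ ^ 2 := by gcongr
        _ = 1 / 4 := by field_simp; norm_num
    have h3 : 0 ≤ ‖v - y‖ ^ 2 * (T / 4)⁻¹ ^ 2 := by positivity
    have e1 : max 0 (1 - ‖v - y‖ ^ 2 * (T / 4)⁻¹ ^ 2) ≤ 1 := max_le (by norm_num) (by linarith)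
    have e2 : (3 : ℝ) / 4 ≤ max 0 (1 - ‖v - x‖ ^ 2 * T⁻¹ ^ 2) := le_max_of_le_right (by linarith)
    have e3 : (3 / 4 : ℝ) ^ 3 ≤ max 0 (1 - ‖v - x‖ ^ 2 * T⁻¹ ^ 2) ^ 3 :=
      pow_le_pow_left₀ (by norm_num) e2 3
    have e4 : max 0 (1 - ‖v - y‖ ^ 2 * (T / 4)⁻¹ ^ 2) ^ 3 ≤ 1 := pow_le_one₀ (le_max_left _ _) e1
    unfold ballKernel kernelProfile
    calc (T / 4)⁻¹ ^ 3 * (315 / 16 * max 0 (1 - ‖v - y‖ ^ 2 * (T / 4)⁻¹ ^ 2) ^ 3)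
        ≤ (T / 4)⁻¹ ^ 3 * (315 / 16 * 1) := by gcongr
      _ = 4096 / 27 * (T⁻¹ ^ 3 * (315 / 16 * (3 / 4) ^ 3)) := by field_simp; norm_num
      _ ≤ _ := by gcongr

theorem InnerProductSpace.HarmonicOnNhd.integral_ballKernel {u : R3 → ℝ} {U : Set R3}
    (hUo : IsOpen U) (hu : HarmonicOnNhd u U) {p : R3} {T : ℝ} (hT : 0 < T)
    (hU : Metric.closedBall p T ⊆ U) : ∫ y, u y * ballKernel T (y - p) = kernelMass * u p :=
  (hu.weaklyHarmonicOn hUo).integral_ballKernel hT hU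
    ((hu.continuousOn.mono hU).integrableOn_compact (isCompact_closedBall p T))
    (hu p (hU (Metric.mem_closedBall_self hT.le))).1.continuousAt

/-- Harnack's inequality on balls. -/
theorem harnack_ball {u : R3 → ℝ} {U : Set R3} (hUo : IsOpen U) (hu : HarmonicOnNhd u U)
    (h0 : ∀ x ∈ U, 0 ≤ u x) {x y : R3} {T : ℝ} (hT : 0 < T) (hU : Metric.closedBall x T ⊆ U)
    (hxy : ‖x - y‖ ≤ T / 4) : u y ≤ 4096 / 27 * u x := by
  have hsub : Metric.closedBall y (T / 4) ⊆ Metric.closedBall x T := fun v hv => by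
    rw [Metric.mem_closedBall, dist_eq_norm] at *
    have := norm_sub_le_norm_sub_add_norm_sub v y x
    rw [norm_sub_rev y x] at this; linarith
  have h1 := hu.integral_ballKernel hUo (by positivity) (hsub.trans hU)
  have h2 := hu.integral_ballKernel hUo hT hU
  have hint : ∀ (z : R3) (t : ℝ), 0 < t → Metric.closedBall z t ⊆ U →
      Integrable fun v => u v * ballKernel t (v - z) := fun z t ht hz =>
    integrable_mul_of_integrableOn_closedBall
      ((hu.continuousOn.mono hz).integrableOn_compact (isCompact_closedBall z t))
      ((contDiff_ballKernel t).continuous.comp (continuous_id.sub continuous_const))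
      fun v hv => ballKernel_eq_zero ht hv.le
  have h3 : ∫ v, u v * ballKernel (T / 4) (v - y)
      ≤ ∫ v, 4096 / 27 * (u v * ballKernel T (v - x)) := by
    refine integral_mono (hint y _ (by positivity) (hsub.trans hU))
      ((hint x T hT hU).const_mul _) fun v => ?_
    simp only
    by_cases hv : v ∈ U
    · have := mul_le_mul_of_nonneg_left (ballKernel_le hT hxy (v := v)) (h0 v hv)
      linarith
    · have h4 : T ≤ ‖v - x‖ := by
        by_contra! hc
        exact hv (hU (by simpa [dist_eq_norm] using hc.le))
      have h5 : T / 4 ≤ ‖v - y‖ := by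
        by_contra! hc
        exact hv (hU (hsub (by simpa [dist_eq_norm] using hc.le)))
      rw [ballKernel_eq_zero hT h4, ballKernel_eq_zero (by positivity) h5]; simp
  rw [integral_const_mul, h1, h2] at h3
  have hA := kernelMass_pos
  have : kernelMass * u y ≤ kernelMass * (4096 / 27 * u x) := by linarith
  exact le_of_mul_le_mul_left this hA

/-- Liouville's theorem for harmonic functions bounded from below. -/
theorem InnerProductSpace.HarmonicOnNhd.eq_const {u : R3 → ℝ} (hu : HarmonicOnNhd u univ)
    (hb : BddBelow (range u)) : ∃ c, ∀ x, u x = c := by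
  refine ⟨⨅ x, u x, fun y => le_antisymm ?_ (ciInf_le hb y)⟩
  set i := ⨅ x, u x with hi
  have hv : HarmonicOnNhd (fun x => u x - i) univ := fun x hx => (hu x hx).sub (harmonicAt_const i)
  -- On all of ℝ³ the radius may depend on x, so the constant is uniform; taking the infimum over x
  -- forces u y = i.
  have key : ∀ x, u y - i ≤ 4096 / 27 * (u x - i) := fun x =>
    harnack_ball isOpen_univ hv (fun z _ => sub_nonneg.2 (ciInf_le hb z))
      (T := 4 * ‖x - y‖ + 1) (by positivity) (subset_univ _) (by linarith)
  have : (u y - i) * (27 / 4096) + i ≤ i := le_ciInf fun x => by linarith [key x]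
  linarith

/-- Harnack's inequality along a segment. -/
theorem harnack_segment {u : R3 → ℝ} {U : Set R3} (hUo : IsOpen U) (hu : HarmonicOnNhd u U)
    (h0 : ∀ x ∈ U, 0 ≤ u x) {x z : R3} {T : ℝ} (hT : 0 < T) {N : ℕ} (hN : 0 < N)
    (hU : ∀ s ∈ Icc (0 : ℝ) 1, Metric.closedBall (x + s • (z - x)) T ⊆ U)
    (hxz : ‖z - x‖ ≤ N * (T / 4)) : u z ≤ (4096 / 27) ^ N * u x := by
  have hN' : (0 : ℝ) < N := by exact_mod_cast hN
  have key : ∀ k : ℕ, k ≤ N →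
      u (x + ((k : ℝ) / N) • (z - x)) ≤ (4096 / 27) ^ k * u x := by
    intro k
    induction k with
    | zero => simp
    | succ k ih =>
      intro hk
      have hk' : (k : ℝ) ≤ N := by exact_mod_cast (Nat.le_of_succ_le hk)
      have h1 := ih (Nat.le_of_succ_le hk)
      have h2 := harnack_ball hUo hu h0 hT
        (hU ((k : ℝ) / N) ⟨by positivity, (div_le_one hN').2 hk'⟩)
        (y := x + (((k + 1 : ℕ) : ℝ) / N) • (z - x)) (by
          have e : x + ((k : ℝ) / N) • (z - x) - (x + (((k + 1 : ℕ) : ℝ) / N) • (z - x))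
              = -((1 / (N : ℝ)) • (z - x)) := by
            push_cast; module
          rw [e, norm_neg, norm_smul, Real.norm_eq_abs, abs_of_pos (by positivity)]
          rw [one_div, inv_mul_le_iff₀ hN']; exact hxz)
      calc _ ≤ _ := h2
        _ ≤ 4096 / 27 * ((4096 / 27) ^ k * u x) := by gcongr
        _ = _ := by ring
  have := key N le_rfl
  rwa [div_self hN'.ne', one_smul, add_sub_cancel] at this

/-- In dimension 3 the span of two vectors has nonzero orthogonal complement. The vector z is the
way-station that joins two points of a sphere by two segments avoiding the centre. -/
theorem exists_orthogonal_norm_eq (a b : R3) {r : ℝ} (hr : 0 ≤ r) :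
    ∃ z : R3, ‖z‖ = r ∧ inner ℝ a z = 0 ∧ inner ℝ b z = 0 := by
  let W : Submodule ℝ R3 := Submodule.span ℝ {a, b}
  have h1 : Module.finrank ℝ W ≤ 2 := by
    have := finrank_span_finset_le_card (R := ℝ) ({a, b} : Finset R3)
    simp only [Finset.coe_insert, Finset.coe_singleton] at this
    exact this.trans Finset.card_le_two
  have h2 := W.finrank_add_finrank_orthogonal
  have h3 : Module.finrank ℝ R3 = 3 := finrank_euclideanSpace_fin
  have h4 : Wᗮ ≠ ⊥ := by
    intro h
    rw [h, finrank_bot, h3] at h2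
    omega
  obtain ⟨z, hz, hz0⟩ := Submodule.exists_mem_ne_zero_of_ne_bot h4
  have hz' := norm_pos_iff.2 hz0
  refine ⟨(r / ‖z‖) • z, ?_, ?_, ?_⟩
  · rw [norm_smul, Real.norm_eq_abs, abs_of_nonneg (by positivity)]; field_simp
  · rw [inner_smul_right, hz a (Submodule.subset_span (by simp)), mul_zero]
  · rw [inner_smul_right, hz b (Submodule.subset_span (by simp)), mul_zero]

/-- The squared norm is ((1 - s)² + s²) r², which lies between r²/2 and r². -/
theorem norm_segment_of_orthogonal {a b : R3} {r : ℝ} (ha : ‖a‖ = r) (hb : ‖b‖ = r)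
    (hab : inner ℝ a b = 0) {s : ℝ} (hs : s ∈ Icc (0 : ℝ) 1) :
    r / 2 ≤ ‖a + s • (b - a)‖ ∧ ‖a + s • (b - a)‖ ≤ r := by
  have hr : 0 ≤ r := ha ▸ norm_nonneg a
  have e : ‖a + s • (b - a)‖ ^ 2 = ((1 - s) ^ 2 + s ^ 2) * r ^ 2 := by
    have : a + s • (b - a) = (1 - s) • a + s • b := by module
    rw [this, norm_add_sq_real, inner_smul_left, inner_smul_right, hab, norm_smul,
      norm_smul, ha, hb, mul_pow, mul_pow, Real.norm_eq_abs, Real.norm_eq_abs, sq_abs, sq_abs]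
    simp; ring
  constructor
  · refine (sq_le_sq₀ (by positivity) (norm_nonneg _)).1 ?_
    rw [e]
    nlinarith [sq_nonneg (s - 1 / 2), mul_nonneg (sq_nonneg (s - 1 / 2)) (sq_nonneg r), sq_nonneg r]
  · refine (sq_le_sq₀ (norm_nonneg _) hr).1 ?_
    rw [e]
    nlinarith [mul_nonneg hs.1 (sub_nonneg.2 hs.2),
      mul_nonneg (mul_nonneg hs.1 (sub_nonneg.2 hs.2)) (sq_nonneg r)]

theorem norm_sub_le_of_norm_eq {a b : R3} {r : ℝ} (ha : ‖a‖ = r) (hb : ‖b‖ = r) :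
    ‖b - a‖ ≤ 2 * r := (norm_sub_le b a).trans (by linarith)

/-- Harnack's inequality on spheres around an isolated singularity. -/
theorem harnack_sphere {u : R3 → ℝ} {p : R3} {R : ℝ}
    (hu : ∀ x, 0 < ‖x - p‖ → ‖x - p‖ < R → HarmonicAt u x)
    (h0 : ∀ x, 0 < ‖x - p‖ → ‖x - p‖ < R → 0 ≤ u x) {x y : R3} {r : ℝ} (hr : 0 < r)
    (hrR : 2 * r ≤ R) (hx : ‖x - p‖ = r) (hy : ‖y - p‖ = r) :
    u y ≤ (4096 / 27) ^ 64 * u x := by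
  let U : Set R3 := {x | 0 < ‖x - p‖ ∧ ‖x - p‖ < R}
  have hcont : Continuous fun x : R3 => ‖x - p‖ := by fun_prop
  have hUo : IsOpen U :=
    (isOpen_lt continuous_const hcont).inter (isOpen_lt hcont continuous_const)
  obtain ⟨z, hz, hxz, hyz⟩ := exists_orthogonal_norm_eq (x - p) (y - p) hr.le
  have step : ∀ a b : R3, ‖a - p‖ = r → ‖b - p‖ = r → inner ℝ (a - p) (b - p) = 0 →
      u b ≤ (4096 / 27) ^ 32 * u a := by
    intro a b ha hb hab
    -- Balls of radius T = r/4 about the segment stay at distance between r/4 and 5r/4 < R from p.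
    -- The segment has length at most 2r = 32 · (T/4), hence 32 steps.
    refine harnack_segment hUo (fun x hx => hu x hx.1 hx.2) (fun x hx => h0 x hx.1 hx.2)
      (T := r / 4) (by positivity) (by norm_num) (fun s hs v hv => ?_) ?_
    · have h1 := norm_segment_of_orthogonal ha hb hab hs
      rw [Metric.mem_closedBall, dist_eq_norm] at hv
      have e : a + s • (b - a) - p = a - p + s • ((b - p) - (a - p)) := by module
      rw [← e] at h1
      have h2 := norm_sub_le_norm_sub_add_norm_sub v (a + s • (b - a)) p
      have h3 := norm_sub_le_norm_sub_add_norm_sub (a + s • (b - a)) v p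
      rw [norm_sub_rev (a + s • (b - a)) v] at h3
      exact ⟨by linarith [h1.1], by linarith [h1.2]⟩
    · have := norm_sub_le_of_norm_eq ha hb
      rw [sub_sub_sub_cancel_right] at this
      push_cast; linarith
  have hz' : ‖z + p - p‖ = r := by simpa using hz
  have h1 := step x (z + p) hx hz' (by simpa using hxz)
  have h2 := step (z + p) y hz' hy (by rw [real_inner_comm]; simpa using hyz)
  calc u y ≤ (4096 / 27) ^ 32 * u (z + p) := h2
    _ ≤ (4096 / 27) ^ 32 * ((4096 / 27) ^ 32 * u x) := by gcongr
    _ = _ := by ring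

end Harnack

/-! ### Cutoff estimates and removability of bounded isolated singularities. -/

section Removable

theorem pderiv_comp_smul {i : Fin 3} {f : R3 → ℝ} {c : ℝ} {p x : R3}
    (hf : DifferentiableAt ℝ f (c • (x - p))) :
    pderiv i (fun y => f (c • (y - p))) x = c * pderiv i f (c • (x - p)) := by
  have h1 : HasFDerivAt (fun y : R3 => c • (y - p)) (c • ContinuousLinearMap.id ℝ R3) x :=
    ((hasFDerivAt_id x).sub_const p).const_smul c
  have h2 := (hf.hasFDerivAt.comp x h1).fderiv
  rw [pderiv, show (fun y => f (c • (y - p))) = f ∘ fun y => c • (y - p) from rfl, h2]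
  simp [pderiv]

theorem laplacian_comp_smul {f : R3 → ℝ} {c : ℝ} {p x : R3} (hf : ContDiff ℝ 2 f) :
    Laplacian.laplacian (fun y => f (c • (y - p))) x
      = c ^ 2 * Laplacian.laplacian f (c • (x - p)) := by
  have hcomp : ContDiff ℝ 2 fun y => f (c • (y - p)) :=
    hf.comp (by fun_prop)
  rw [laplacian_eq_sum_pderiv hcomp.contDiffAt, laplacian_eq_sum_pderiv hf.contDiffAt,
    Finset.mul_sum]
  refine Finset.sum_congr rfl fun i _ => ?_
  have e : pderiv i (fun y => f (c • (y - p))) = fun y => c * pderiv i f (c • (y - p)) :=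
    funext fun y => pderiv_comp_smul (hf.differentiable (by norm_num) _)
  have hd : ∀ y, DifferentiableAt ℝ (pderiv i f) y := fun y => hf.contDiffAt.differentiableAt_pderiv
  have hd' : DifferentiableAt ℝ (fun y => pderiv i f (c • (y - p))) x :=
    (hd _).comp x (by fun_prop)
  rw [e, pderiv_mul (differentiableAt_const c) hd', pderiv_comp_smul (hd _)]
  simp [pderiv]
  ring

theorem ContDiff.continuous_pderiv {f : R3 → ℝ} (hf : ContDiff ℝ 2 f) (i : Fin 3) :
    Continuous (_root_.pderiv i f) :=
  (contDiff_iff_contDiffAt.2 fun x => hf.contDiffAt.pderiv (m := 1) (by norm_num)).continuous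

theorem ContDiff.continuous_laplacian {f : R3 → ℝ} (hf : ContDiff ℝ 2 f) :
    Continuous (Laplacian.laplacian f) := by
  have e : Laplacian.laplacian f = fun x => ∑ i, _root_.pderiv i (_root_.pderiv i f) x :=
    funext fun x => laplacian_eq_sum_pderiv hf.contDiffAt
  rw [e]
  refine continuous_finsetSum _ fun i _ => ?_
  have h1 : ContDiff ℝ 1 (_root_.pderiv i f) :=
    contDiff_iff_contDiffAt.2 fun x => hf.contDiffAt.pderiv (by norm_num)
  exact (contDiff_iff_contDiffAt.2 fun x => h1.contDiffAt.pderiv (m := 0) (by simp)).continuous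

theorem laplacian_eq_zero_of_notMem_tsupport {f : R3 → ℝ} {x : R3} (hx : x ∉ tsupport f) :
    Laplacian.laplacian f x = 0 := by
  have h : f =ᶠ[𝓝 x] fun _ => 0 := notMem_tsupport_iff_eventuallyEq.1 hx
  rw [(laplacian_congr_nhds h).self_of_nhds]
  simp

theorem HasCompactSupport.exists_abs_le {f : R3 → ℝ} (hf : HasCompactSupport f)
    (hc : Continuous f) : ∃ C, 0 ≤ C ∧ ∀ x, |f x| ≤ C := by
  obtain ⟨C, hC⟩ := hf.exists_bound_of_continuous hc
  exact ⟨C, (norm_nonneg _).trans (hC 0), hC⟩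

theorem hasCompactSupport_laplacian {f : R3 → ℝ} (hf : HasCompactSupport f) :
    HasCompactSupport (Laplacian.laplacian f) :=
  HasCompactSupport.of_support_subset_isCompact hf fun _ hx =>
    not_not.1 fun h => hx (laplacian_eq_zero_of_notMem_tsupport h)

/-- Truncating a test function near a point costs at most `O(ε⁻²)` in the Laplacian. -/
theorem exists_abs_laplacian_cutoff_le (p : R3) {ψ : R3 → ℝ} (hψ : ContDiff ℝ 2 ψ)
    (hc : HasCompactSupport ψ) : ∃ K, 0 ≤ K ∧ ∀ ε, 0 < ε → ε ≤ 1 → ∃ χ : R3 → ℝ, ContDiff ℝ 2 χ ∧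
      (∀ᶠ y in 𝓝 p, χ y = 1) ∧ tsupport χ ⊆ Metric.closedBall p (2 * ε) ∧
      ∀ y, |Laplacian.laplacian (fun y => χ y * ψ y) y| ≤ K * (ε⁻¹) ^ 2 := by
  let b : ContDiffBump (0 : R3) := ⟨1, 2, by norm_num, by norm_num⟩
  have hb : ContDiff ℝ 2 b := b.contDiff
  have hbc : HasCompactSupport b := b.hasCompactSupport
  have hpc : ∀ (f : R3 → ℝ), HasCompactSupport f → ∀ i, HasCompactSupport (pderiv i f) :=
    fun f hf i => hf.of_isClosed_subset (isClosed_tsupport _) (tsupport_pderiv_subset i f)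
  obtain ⟨B0, hB0, hB0'⟩ := hbc.exists_abs_le hb.continuous
  obtain ⟨B2, hB2, hB2'⟩ := (hasCompactSupport_laplacian hbc).exists_abs_le hb.continuous_laplacian
  choose B1 hB1 hB1' using fun i => (hpc b hbc i).exists_abs_le (hb.continuous_pderiv i)
  obtain ⟨P0, hP0, hP0'⟩ := hc.exists_abs_le hψ.continuous
  obtain ⟨P2, hP2, hP2'⟩ := (hasCompactSupport_laplacian hc).exists_abs_le hψ.continuous_laplacian
  choose P1 hP1 hP1' using fun i => (hpc ψ hc i).exists_abs_le (hψ.continuous_pderiv i)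
  refine ⟨B0 * P2 + P0 * B2 + 2 * ∑ i, B1 i * P1 i, ?_, fun ε hε hε1 => ?_⟩
  · have : 0 ≤ ∑ i, B1 i * P1 i := Finset.sum_nonneg fun i _ => mul_nonneg (hB1 i) (hP1 i)
    positivity
  have hε' : 1 ≤ ε⁻¹ := (one_le_inv₀ hε).2 hε1
  have hχ : ContDiff ℝ 2 fun y : R3 => b (ε⁻¹ • (y - p)) :=
    hb.comp (by fun_prop)
  refine ⟨fun y => b (ε⁻¹ • (y - p)), hχ, ?_, ?_, fun y => ?_⟩
  · filter_upwards [Metric.closedBall_mem_nhds p hε] with y hy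
    refine b.one_of_mem_closedBall ?_
    rw [Metric.mem_closedBall, dist_eq_norm] at hy
    rw [Metric.mem_closedBall, dist_zero_right, norm_smul, Real.norm_eq_abs,
      abs_of_pos (by positivity), inv_mul_le_iff₀ hε]
    simpa [b] using hy
  · refine closure_minimal (fun y hy => ?_) Metric.isClosed_closedBall
    by_contra h
    refine hy (b.zero_of_le_dist ?_)
    rw [Metric.mem_closedBall, dist_eq_norm, not_le] at h
    rw [dist_zero_right, norm_smul, Real.norm_eq_abs, abs_of_pos (by positivity), ← div_eq_inv_mul,
      le_div_iff₀ hε]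
    exact h.le
  · rw [laplacian_mul (f := fun y => b (ε⁻¹ • (y - p))) hχ.contDiffAt hψ.contDiffAt,
      laplacian_comp_smul hb]
    have hε2 : ε⁻¹ ≤ ε⁻¹ ^ 2 := by nlinarith
    have hε3 : 1 ≤ ε⁻¹ ^ 2 := by nlinarith
    have hε0 : 0 ≤ ε⁻¹ := by positivity
    have t1 : |b (ε⁻¹ • (y - p)) * Laplacian.laplacian ψ y| ≤ (B0 * P2) * ε⁻¹ ^ 2 := by
      rw [abs_mul]
      calc _ ≤ B0 * P2 := mul_le_mul (hB0' _) (hP2' _) (abs_nonneg _) hB0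
        _ ≤ _ := le_mul_of_one_le_right (by positivity) hε3
    have t2 : |ψ y * (ε⁻¹ ^ 2 * Laplacian.laplacian (b : R3 → ℝ) (ε⁻¹ • (y - p)))|
        ≤ (P0 * B2) * ε⁻¹ ^ 2 := by
      rw [abs_mul, abs_mul, abs_of_nonneg (a := ε⁻¹ ^ 2) (by positivity)]
      calc _ ≤ P0 * (ε⁻¹ ^ 2 * B2) := mul_le_mul (hP0' _)
            (mul_le_mul_of_nonneg_left (hB2' _) (by positivity)) (by positivity) hP0
        _ = _ := by ring
    have t3 : |∑ i, pderiv i (fun y => b (ε⁻¹ • (y - p))) y * pderiv i ψ y|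
        ≤ (∑ i, B1 i * P1 i) * ε⁻¹ ^ 2 := by
      refine (Finset.abs_sum_le_sum_abs _ _).trans ?_
      rw [Finset.sum_mul]
      refine Finset.sum_le_sum fun i _ => ?_
      rw [pderiv_comp_smul (hb.differentiable (by norm_num) _), abs_mul, abs_mul, abs_of_nonneg hε0]
      calc _ ≤ (ε⁻¹ * B1 i) * P1 i := mul_le_mul
            (mul_le_mul_of_nonneg_left (hB1' i _) hε0) (hP1' i _) (abs_nonneg _)
              (mul_nonneg hε0 (hB1 i))
        _ = (B1 i * P1 i) * ε⁻¹ := by ring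
        _ ≤ _ := mul_le_mul_of_nonneg_left hε2 (mul_nonneg (hB1 i) (hP1 i))
    refine (abs_add_le _ _).trans ?_
    have := abs_add_le (b (ε⁻¹ • (y - p)) * Laplacian.laplacian ψ y)
      (ψ y * (ε⁻¹ ^ 2 * Laplacian.laplacian (b : R3 → ℝ) (ε⁻¹ • (y - p))))
    rw [abs_mul 2, abs_two]
    linarith

theorem measureReal_closedBall_le (p : R3) {r : ℝ} (hr : 0 ≤ r) :
    volume.real (Metric.closedBall p r) = r ^ 3 * volume.real (Metric.ball (0 : R3) 1) := by
  rw [measureReal_def, Measure.addHaar_closedBall _ _ hr, ENNReal.toReal_mul,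
    ENNReal.toReal_ofReal (by positivity), finrank_euclideanSpace_fin, measureReal_def]

section

variable {w : R3 → ℝ} {p : R3} {R M : ℝ}

theorem integrableOn_of_bounded_harmonic
    (hw : ∀ x, 0 < ‖x - p‖ → ‖x - p‖ ≤ R → HarmonicAt w x)
    (hM : ∀ x, 0 < ‖x - p‖ → ‖x - p‖ ≤ R → |w x| ≤ M) :
    IntegrableOn w (Metric.closedBall p R) := by
  let s : Set R3 := Metric.closedBall p R \ {p}
  have hs : MeasurableSet s :=
    Metric.isClosed_closedBall.measurableSet.diff (measurableSet_singleton p)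
  have hmem : ∀ x ∈ s, 0 < ‖x - p‖ ∧ ‖x - p‖ ≤ R := fun x hx =>
    ⟨norm_pos_iff.2 (sub_ne_zero.2 hx.2), by simpa [dist_eq_norm] using hx.1⟩
  have hcs : ContinuousOn w s := fun x hx =>
    (hw x (hmem x hx).1 (hmem x hx).2).1.continuousAt.continuousWithinAt
  have h1 : IntegrableOn w s := by
    refine IntegrableOn.of_bound (C := M) ?_ (hcs.aestronglyMeasurable hs) ?_
    · exact (measure_mono sdiff_subset).trans_lt (isCompact_closedBall p R).measure_lt_top
    · exact (ae_restrict_mem hs).mono fun x hx => hM x (hmem x hx).1 (hmem x hx).2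
  refine h1.congr_set_ae ?_
  exact (sdiff_null_ae_eq_self (measure_singleton p)).symm

/-- Split ψ = (1 - χ)ψ + χψ with a cutoff χ at scale ε. The first part avoids p and contributes 0.
The second contributes at most M · Kε⁻² times the volume of a ball of radius 2ε, which is O(ε). -/
theorem weaklyHarmonicOn_of_bounded_harmonic
    (hw : ∀ x, 0 < ‖x - p‖ → ‖x - p‖ ≤ R → HarmonicAt w x)
    (hM : ∀ x, 0 < ‖x - p‖ → ‖x - p‖ ≤ R → |w x| ≤ M) :
    WeaklyHarmonicOn w (Metric.ball p R) := by
  intro ψ hψ hc hs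
  have hint := integrableOn_of_bounded_harmonic hw hM
  have hcont : Continuous fun x : R3 => ‖x - p‖ := by fun_prop
  let V : Set R3 := {x | 0 < ‖x - p‖ ∧ ‖x - p‖ < R}
  have hV : IsOpen V :=
    (isOpen_lt continuous_const hcont).inter (isOpen_lt hcont continuous_const)
  have hwV : WeaklyHarmonicOn w V :=
    HarmonicOnNhd.weaklyHarmonicOn hV fun x hx => hw x hx.1 hx.2.le
  obtain ⟨K, hK, hcut⟩ := exists_abs_laplacian_cutoff_le p hψ hc
  rcases le_or_gt R 0 with hR | hR
  · refine integral_eq_zero_of_ae (Eventually.of_forall fun y => ?_)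
    have : tsupport ψ = ∅ := by
      rw [Metric.ball_eq_empty.2 hR] at hs; exact subset_empty_iff.1 hs
    simp [laplacian_eq_zero_of_notMem_tsupport (f := ψ) (x := y) (by simp [this])]
  have hM0 : 0 ≤ M := by
    obtain ⟨z, hz, -⟩ := exists_orthogonal_norm_eq 0 0 hR.le
    exact (abs_nonneg _).trans (hM (z + p) (by simpa [hz]) (by simp [hz]))
  set v := volume.real (Metric.ball (0 : R3) 1) with hv
  have bound : ∀ ε, 0 < ε → ε ≤ 1 → 2 * ε ≤ R →
      |∫ y, w y * Laplacian.laplacian ψ y| ≤ (8 * M * K * v) * ε := by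
    intro ε hε hε1 hεR
    obtain ⟨χ, hχ, hχ1, hχs, hχb⟩ := hcut ε hε hε1
    have h1 : ContDiff ℝ 2 fun y => (1 - χ y) * ψ y := (contDiff_const.sub hχ).mul hψ
    have h2 : ContDiff ℝ 2 fun y => χ y * ψ y := hχ.mul hψ
    have hts : tsupport (fun y => (1 - χ y) * ψ y) ⊆ tsupport ψ :=
      closure_mono fun y hy hy' => hy (by simp [hy'])
    have hts2 : tsupport (fun y => χ y * ψ y) ⊆ tsupport ψ :=
      closure_mono fun y hy hy' => hy (by simp [hy'])
    have hts3 : tsupport (fun y => χ y * ψ y) ⊆ tsupport χ :=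
      closure_mono fun y hy hy' => hy (by simp [hy'])
    have hz := hwV _ h1 (hc.of_isClosed_subset (isClosed_tsupport _) hts) fun y hy => by
      refine ⟨norm_pos_iff.2 (sub_ne_zero.2 ?_), by simpa [dist_eq_norm] using hs (hts hy)⟩
      rintro rfl
      refine notMem_tsupport_iff_eventuallyEq.2 ?_ hy
      filter_upwards [hχ1] with z hz
      simp [hz]
    have hint' : ∀ f : R3 → ℝ, ContDiff ℝ 2 f → tsupport f ⊆ tsupport ψ →
        Integrable fun y => w y * Laplacian.laplacian f y := fun f hf hfs =>
      integrable_mul_of_integrableOn_closedBall hint hf.continuous_laplacian fun y hy =>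
        laplacian_eq_zero_of_notMem_tsupport fun h => by
          have := hs (hfs h); rw [Metric.mem_ball, dist_eq_norm] at this; linarith
    have hsum : ∀ y, w y * Laplacian.laplacian ψ y
        = w y * Laplacian.laplacian (fun y => (1 - χ y) * ψ y) y
          + w y * Laplacian.laplacian (fun y => χ y * ψ y) y := fun y => by
      have h3 := h1.contDiffAt.laplacian_add (h2.contDiffAt (x := y))
      have e : ((fun y => (1 - χ y) * ψ y) + fun y => χ y * ψ y) = ψ := by
        ext y; simp; ring
      rw [e] at h3
      rw [h3]; ring
    simp only [hsum]
    rw [integral_add (hint' _ h1 hts) (hint' _ h2 hts2), hz, zero_add]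
    have hout : ∀ y, y ∉ Metric.closedBall p (2 * ε) →
        w y * Laplacian.laplacian (fun y => χ y * ψ y) y = 0 := fun y hy => by
      rw [laplacian_eq_zero_of_notMem_tsupport fun h => hy (hχs (hts3 h)), mul_zero]
    rw [← setIntegral_eq_integral_of_forall_compl_eq_zero hout]
    have hb := norm_setIntegral_le_of_norm_le_const_ae' (μ := volume)
      (s := Metric.closedBall p (2 * ε))
      (f := fun y => w y * Laplacian.laplacian (fun y => χ y * ψ y) y)
      (C := M * (K * ε⁻¹ ^ 2)) (isCompact_closedBall _ _).measure_lt_top (by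
        have hne : ∀ᵐ y : R3, y ≠ p := by simp [ae_iff]
        filter_upwards [hne] with y hy hy2
        rw [Metric.mem_closedBall, dist_eq_norm] at hy2
        rw [Real.norm_eq_abs, abs_mul]
        exact mul_le_mul (hM y (norm_pos_iff.2 (sub_ne_zero.2 hy)) (hy2.trans hεR)) (hχb y)
          (abs_nonneg _) hM0)
    refine hb.trans (le_of_eq ?_)
    rw [measureReal_closedBall_le p (by positivity), ← hv]
    field_simp
    ring
  have hlim : Tendsto (fun ε : ℝ => (8 * M * K * v) * ε) (𝓝[>] 0) (𝓝 0) := by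
    have : Tendsto (fun ε : ℝ => (8 * M * K * v) * ε) (𝓝 0) (𝓝 ((8 * M * K * v) * 0)) :=
      tendsto_id.const_mul _
    rw [mul_zero] at this
    exact this.mono_left nhdsWithin_le_nhds
  have h0 : |∫ y, w y * Laplacian.laplacian ψ y| ≤ 0 := by
    refine ge_of_tendsto hlim ?_
    filter_upwards [Ioo_mem_nhdsGT (show (0 : ℝ) < min 1 (R / 2) by positivity)] with ε hε
    have h1 := hε.2.trans_le (min_le_left _ _)
    have h2 := hε.2.trans_le (min_le_right _ _)
    exact bound ε hε.1 h1.le (by linarith)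
  exact abs_nonpos_iff.1 h0

/-- Bounded isolated singularities of harmonic functions are removable. -/
theorem exists_harmonicAt_extension (hR : 0 < R)
    (hw : ∀ x, 0 < ‖x - p‖ → ‖x - p‖ ≤ R → HarmonicAt w x)
    (hM : ∀ x, 0 < ‖x - p‖ → ‖x - p‖ ≤ R → |w x| ≤ M) :
    ∃ h : R3 → ℝ, HarmonicAt h p ∧ h =ᶠ[𝓝[≠] p] w := by
  have hint := integrableOn_of_bounded_harmonic hw hM
  have hweak := weaklyHarmonicOn_of_bounded_harmonic hw hM
  have hA := kernelMass_pos
  let f : R3 → ℝ := (Metric.closedBall p R).indicator w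
  have hf : Integrable f := hint.integrable_indicator Metric.isClosed_closedBall.measurableSet
  let T := R / 2
  have hT : 0 < T := by positivity
  have hkc : HasCompactSupport (ballKernel T) :=
    HasCompactSupport.of_support_subset_isCompact (isCompact_closedBall 0 T) fun z hz => by
      by_contra h
      exact hz (ballKernel_eq_zero hT (by simpa using (not_le.1 (by simpa using h)).le))
  -- The extension is the kernel average of w: it inherits C² regularity from the kernel, and it
  -- equals w off p by the mean value property of the weakly harmonic w.
  let h : R3 → ℝ := fun x => kernelMass⁻¹ *
    (convolution f (ballKernel T) (ContinuousLinearMap.mul ℝ ℝ) volume) x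
  have hh : ContDiff ℝ 2 h := contDiff_const.mul
    (hkc.contDiff_convolution_right (n := 2) _ hf.locallyIntegrable (contDiff_ballKernel T))
  have heq : ∀ x, 0 < ‖x - p‖ → ‖x - p‖ < T → h x = w x := by
    intro x hx hxT
    have hsub : Metric.closedBall x T ⊆ Metric.ball p R := fun y hy => by
      rw [Metric.mem_closedBall, dist_eq_norm] at hy
      rw [Metric.mem_ball, dist_eq_norm]
      have := norm_sub_le_norm_sub_add_norm_sub y x p
      have : T + T = R := by simp [T]
      linarith
    have hmv := hweak.integral_ballKernel hT hsub
      (hint.mono_set (hsub.trans Metric.ball_subset_closedBall))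
      (hw x hx (by have : T + T = R := by simp [T]
                   linarith)).1.continuousAt
    have e : (convolution f (ballKernel T) (ContinuousLinearMap.mul ℝ ℝ) volume) x
        = ∫ y, w y * ballKernel T (y - x) := by
      rw [convolution_def]
      refine integral_congr_ae (Eventually.of_forall fun y => ?_)
      simp only [ContinuousLinearMap.mul_apply']
      have es : ballKernel T (x - y) = ballKernel T (y - x) := by
        simp only [ballKernel, norm_sub_rev]
      rw [es]
      by_cases hy : y ∈ Metric.closedBall p R
      · simp only [f, indicator_of_mem hy]
      · have : T ≤ ‖y - x‖ := by
          by_contra! hc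
          exact hy (Metric.ball_subset_closedBall (hsub (by simpa [dist_eq_norm] using hc.le)))
        rw [ballKernel_eq_zero hT this]; simp
    simp only [h, e, hmv]
    field_simp
  have hcont : Continuous fun x : R3 => ‖x - p‖ := by fun_prop
  have hnear : ∀ᶠ x in 𝓝 p, ‖x - p‖ < T :=
    hcont.continuousAt.eventually (gt_mem_nhds (by simpa using hT))
  have hev : h =ᶠ[𝓝[≠] p] w := by
    filter_upwards [nhdsWithin_le_nhds hnear, self_mem_nhdsWithin] with x hx hxp
    exact heq x (norm_pos_iff.2 (sub_ne_zero.2 hxp)) hx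
  have hlap : ∀ x, 0 < ‖x - p‖ → ‖x - p‖ < T → Laplacian.laplacian h x = 0 := by
    intro x hx hxT
    have e : h =ᶠ[𝓝 x] w := by
      filter_upwards [hcont.continuousAt.eventually (lt_mem_nhds hx),
        hcont.continuousAt.eventually (gt_mem_nhds hxT)] with y h1 h2 using heq y h1 h2
    rw [(laplacian_congr_nhds e).self_of_nhds]
    exact (hw x hx (by have : T + T = R := by simp [T]
                       linarith)).2.self_of_nhds
  have hlapev : ∀ᶠ x in 𝓝[≠] p, Laplacian.laplacian h x = 0 := by
    filter_upwards [nhdsWithin_le_nhds hnear, self_mem_nhdsWithin] with x hx hxp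
    exact hlap x (norm_pos_iff.2 (sub_ne_zero.2 hxp)) hx
  -- The Laplacian of h is continuous and vanishes on a punctured neighbourhood of p, hence also at
  -- p.
  have hlapp : Laplacian.laplacian h p = 0 := by
    have h1 : Tendsto (Laplacian.laplacian h) (𝓝[≠] p) (𝓝 (Laplacian.laplacian h p)) :=
      hh.continuous_laplacian.continuousAt.tendsto.mono_left nhdsWithin_le_nhds
    have h2 : Tendsto (Laplacian.laplacian h) (𝓝[≠] p) (𝓝 0) :=
      tendsto_const_nhds.congr' (EventuallyEq.symm hlapev)
    exact tendsto_nhds_unique h1 h2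
  refine ⟨h, ⟨hh.contDiffAt, ?_⟩, hev⟩
  filter_upwards [hnear] with x hx
  rcases eq_or_ne x p with rfl | hxp
  · exact hlapp
  · exact hlap x (norm_pos_iff.2 (sub_ne_zero.2 hxp)) hx

end

end Removable

/-! ### Bôcher's theorem and the explicit form of φ. -/

section Bocher

theorem exists_norm_sub_eq (p : R3) {r : ℝ} (hr : 0 ≤ r) : ∃ x : R3, ‖x - p‖ = r := by
  obtain ⟨z, hz, -⟩ := exists_orthogonal_norm_eq 0 0 hr
  exact ⟨z + p, by simpa using hz⟩

/-- Bôcher's theorem: a nonnegative harmonic function with an isolated singularity is the sum of a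
nonnegative multiple of the fundamental solution and a harmonic function. -/
theorem bocher {u : R3 → ℝ} {p : R3} {R : ℝ} (hR : 0 < R)
    (hu : ∀ x, 0 < ‖x - p‖ → ‖x - p‖ ≤ R → HarmonicAt u x)
    (h0 : ∀ x, 0 < ‖x - p‖ → ‖x - p‖ ≤ R → 0 ≤ u x) :
    ∃ m : ℝ, 0 ≤ m ∧ ∃ h : R3 → ℝ, HarmonicAt h p ∧
      h =ᶠ[𝓝[≠] p] fun x => u x - m * ‖x - p‖⁻¹ := by
  -- The mass m is the largest K for which K times the fundamental solution vanishing on the sphere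
  -- of radius R fits below u. The remainder w is then shown to be bounded.
  let A : Set ℝ := {K | 0 ≤ K ∧ ∀ x, 0 < ‖x - p‖ → ‖x - p‖ ≤ R → K * (‖x - p‖⁻¹ - R⁻¹) ≤ u x}
  have hA0 : (0 : ℝ) ∈ A := ⟨le_rfl, fun x hx hxR => by simpa using h0 x hx hxR⟩
  have hnn : ∀ x, 0 < ‖x - p‖ → ‖x - p‖ ≤ R → 0 ≤ ‖x - p‖⁻¹ - R⁻¹ := fun x hx hxR =>
    sub_nonneg.2 (inv_anti₀ hx hxR)
  have hAb : BddAbove A := by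
    obtain ⟨x, hx⟩ := exists_norm_sub_eq p (r := R / 2) (by positivity)
    refine ⟨R * u x, fun K hK => ?_⟩
    have h1 := hK.2 x (by rw [hx]; positivity) (by rw [hx]; linarith)
    rw [hx] at h1
    have : (R / 2)⁻¹ - R⁻¹ = R⁻¹ := by field_simp; norm_num
    rw [this] at h1
    calc K = R * (K * R⁻¹) := by field_simp
      _ ≤ R * u x := by gcongr
  set m := sSup A with hm
  have hm0 : 0 ≤ m := le_csSup hAb hA0
  have hmA : ∀ x, 0 < ‖x - p‖ → ‖x - p‖ ≤ R → m * (‖x - p‖⁻¹ - R⁻¹) ≤ u x := by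
    intro x hx hxR
    rcases (hnn x hx hxR).eq_or_lt with h | h
    · rw [← h]; simpa using h0 x hx hxR
    · rw [← le_div_iff₀ h]
      exact csSup_le ⟨0, hA0⟩ fun K hK => (le_div_iff₀ h).2 (hK.2 x hx hxR)
  let w : R3 → ℝ := fun x => u x - (m * ‖x - p‖⁻¹ + -(m * R⁻¹))
  have hw0 : ∀ x, 0 < ‖x - p‖ → ‖x - p‖ ≤ R → 0 ≤ w x := fun x hx hxR => by
    have := hmA x hx hxR
    simp only [w]; linarith
  have hne : ∀ x, 0 < ‖x - p‖ → x ≠ p := fun x hx => sub_ne_zero.1 (norm_pos_iff.1 hx)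
  have hw : ∀ x, 0 < ‖x - p‖ → ‖x - p‖ ≤ R → HarmonicAt w x := fun x hx hxR =>
    (hu x hx hxR).sub_const_mul_inv_dist (hne x hx) _ _
  -- Maximality of m: if w ≥ ε/‖x - p‖ near p, comparison on a shell would give w ≥ ε(‖x - p‖⁻¹ -
  -- R⁻¹) throughout, so m + ε ∈ A.
  have hsmall : ∀ ε, 0 < ε → ∀ r0, 0 < r0 → ∃ x, 0 < ‖x - p‖ ∧ ‖x - p‖ < r0 ∧
      w x < ε * ‖x - p‖⁻¹ := by
    intro ε hε r0 hr0
    by_contra! hcon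
    have hmem : m + ε ∈ A := by
      refine ⟨by positivity, fun x hx hxR => ?_⟩
      suffices h : ε * (‖x - p‖⁻¹ - R⁻¹) ≤ w x by simp only [w] at h; linarith
      have hRi : 0 ≤ ε * R⁻¹ := by positivity
      rcases lt_or_ge ‖x - p‖ r0 with hxr | hxr
      · have := hcon x hx hxr
        linarith
      · set r1 := min r0 R / 2 with hr1
        have hmin : 0 < min r0 R := lt_min hr0 hR
        have hr1p : 0 < r1 := by positivity
        have hr1r0 : r1 < r0 := by have := min_le_left r0 R; linarith
        have hr1R : r1 < R := by have := min_le_right r0 R; linarith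
        have := le_of_harmonicAt_annulus (u := -w) (p := p) (r := r1) (R := R) (a := -ε)
          (b := ε * R⁻¹) hr1p (fun x h1 h2 => (hw x (hr1p.trans_le h1) h2).neg)
          (fun x h1 => by
            have := hcon x (by rw [h1]; exact hr1p) (by rw [h1]; exact hr1r0)
            rw [h1] at this
            simp only [Pi.neg_apply]; linarith)
          (fun x h1 => by
            have := hw0 x (by rw [h1]; exact hR) h1.le
            simp only [Pi.neg_apply]; linarith) (x := x) (hr1r0.le.trans hxr) hxR
        simp only [Pi.neg_apply] at this
        linarith
    have := le_csSup hAb hmem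
    linarith
  obtain ⟨M, hM⟩ : ∃ M, ∀ x, ‖x - p‖ = R → w x ≤ M := by
    have hc : IsCompact (Metric.sphere p R) := isCompact_sphere p R
    have hcw : ContinuousOn w (Metric.sphere p R) := fun x hx => by
      rw [mem_sphere_iff_norm] at hx
      exact (hw x (by rw [hx]; exact hR) hx.le).1.continuousAt.continuousWithinAt
    obtain ⟨M, hM⟩ := hc.bddAbove_image hcw
    exact ⟨M, fun x hx => hM ⟨x, mem_sphere_iff_norm.2 hx, rfl⟩⟩
  have hM0 : 0 ≤ M := by
    obtain ⟨x, hx⟩ := exists_norm_sub_eq p hR.le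
    exact (hw0 x (by rw [hx]; exact hR) hx.le).trans (hM x hx)
  have hwM : ∀ x, 0 < ‖x - p‖ → ‖x - p‖ ≤ R → w x ≤ M := by
    intro x hx hxR
    -- Harnack spreads the smallness of w at one point x1 to the whole sphere through x1. Comparison
    -- between that sphere and the outer one, where w ≤ M, gives the bound, and ε → 0 leaves w ≤ M.
    have key : ∀ ε, 0 < ε → w x ≤ (4096 / 27) ^ 64 * ε * ‖x - p‖⁻¹ + M := by
      intro ε hε
      obtain ⟨x1, hx1, hx1r, hx1w⟩ := hsmall ε hε (min ‖x - p‖ (R / 2)) (by positivity)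
      set r := ‖x1 - p‖ with hr
      have h1 : r < ‖x - p‖ := hx1r.trans_le (min_le_left _ _)
      have h2 : r < R / 2 := hx1r.trans_le (min_le_right _ _)
      refine le_of_harmonicAt_annulus hx1 (fun y h1 h2 => hw y (hx1.trans_le h1) h2)
        (fun y hy => ?_) (fun y hy => ?_) h1.le hxR
      · have := harnack_sphere (u := w) (fun x h1 h2 => hw x h1 h2.le)
          (fun x h1 h2 => hw0 x h1 h2.le)
          hx1 (by linarith) hr.symm hy
        calc w y ≤ (4096 / 27) ^ 64 * w x1 := this
          _ ≤ (4096 / 27) ^ 64 * (ε * r⁻¹) := by gcongr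
          _ ≤ _ := by linarith
      · have := hM y hy
        have : 0 ≤ (4096 / 27) ^ 64 * ε * R⁻¹ := by positivity
        linarith
    have hlim : Tendsto (fun ε : ℝ => (4096 / 27) ^ 64 * ε * ‖x - p‖⁻¹ + M) (𝓝[>] 0) (𝓝 M) := by
      have : Tendsto (fun ε : ℝ => (4096 / 27) ^ 64 * ε * ‖x - p‖⁻¹ + M) (𝓝 0)
          (𝓝 ((4096 / 27) ^ 64 * 0 * ‖x - p‖⁻¹ + M)) := Continuous.tendsto (by fun_prop) 0
      rw [mul_zero, zero_mul, zero_add] at this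
      exact this.mono_left nhdsWithin_le_nhds
    refine ge_of_tendsto hlim ?_
    filter_upwards [self_mem_nhdsWithin] with ε hε using key ε hε
  obtain ⟨h, hh, hhw⟩ := exists_harmonicAt_extension hR hw (M := M) fun x hx hxR => by
    rw [abs_of_nonneg (hw0 x hx hxR)]; exact hwM x hx hxR
  refine ⟨m, hm0, h - fun _ => m * R⁻¹, hh.sub (harmonicAt_const _), ?_⟩
  filter_upwards [hhw] with x hx
  simp only [Pi.sub_apply, hx, w]
  ring

theorem harmonicAt_sum {ι : Type*} {s : Finset ι} {f : ι → R3 → ℝ} {x : R3}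
    (h : ∀ i ∈ s, HarmonicAt (f i) x) : HarmonicAt (fun y => ∑ i ∈ s, f i y) x := by
  classical
  induction s using Finset.induction_on with
  | empty => simp
  | insert a s ha ih =>
    simp only [Finset.sum_insert ha]
    exact (h a (by simp)).add (ih fun i hi => h i (by simp [hi]))

/-- Bôcher's coefficient cannot be 0, since φ would then extend harmonically across p. -/
theorem HasIsolatedSingularityAt.exists_pole {φ : R3 → ℝ} {p : R3}
    (hp : HasIsolatedSingularityAt φ p) (hpos : ∀ᶠ x in 𝓝[≠] p, 0 ≤ φ x) :
    ∃ m : ℝ, 0 < m ∧ ∃ h : R3 → ℝ, HarmonicAt h p ∧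
      h =ᶠ[𝓝[≠] p] fun x => φ x - m * ‖x - p‖⁻¹ := by
  obtain ⟨ε, hε, hball⟩ := Metric.mem_nhdsWithin_iff.1 (hp.1.and hpos)
  have hmem : ∀ x, 0 < ‖x - p‖ → ‖x - p‖ ≤ ε / 2 → HarmonicAt φ x ∧ 0 ≤ φ x := fun x hx hxε =>
    hball ⟨by rw [Metric.mem_ball, dist_eq_norm]; linarith, sub_ne_zero.1 (norm_pos_iff.1 hx)⟩
  obtain ⟨m, hm, h, hh, hhe⟩ := bocher (R := ε / 2) (by positivity)
    (fun x h1 h2 => (hmem x h1 h2).1) (fun x h1 h2 => (hmem x h1 h2).2)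
  rcases hm.eq_or_lt with rfl | hm
  · exact absurd ⟨h, hh, by simpa using hhe⟩ hp.2
  · exact ⟨m, hm, h, hh, hhe⟩

theorem eventually_notMem_finset (S : Finset R3) (p : R3) : ∀ᶠ x in 𝓝[≠] p, x ∉ S := by
  have h : (↑(S.erase p) : Set R3)ᶜ ∈ 𝓝 p :=
    (S.erase p).finite_toSet.isClosed.isOpen_compl.mem_nhds (by simp)
  filter_upwards [nhdsWithin_le_nhds h, self_mem_nhdsWithin] with x hx hxp hxS
  exact hx (by simpa using ⟨hxS, hxp⟩)

/-- A positive harmonic function on the complement of a finite set of genuine singularities is a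
multi-centre Gibbons–Hawking potential. -/
theorem exists_eq_const_add_sum_inv_dist {φ : R3 → ℝ} {S : Finset R3}
    (hφ : HarmonicOnNhd φ (↑S : Set R3)ᶜ) (hpos : ∀ q ∈ (↑S : Set R3)ᶜ, 0 < φ q)
    (hS : ∀ p ∈ S, HasIsolatedSingularityAt φ p) :
    ∃ (c : ℝ) (m : R3 → ℝ), (∀ p ∈ S, 0 < m p) ∧
      ∀ x, x ∉ S → φ x = c + ∑ p ∈ S, m p * ‖x - p‖⁻¹ := by
  classical
  have hpole : ∀ p : R3, ∃ m : ℝ, p ∈ S → 0 < m ∧ ∃ h : R3 → ℝ, HarmonicAt h p ∧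
      h =ᶠ[𝓝[≠] p] fun x => φ x - m * ‖x - p‖⁻¹ := by
    intro p
    by_cases hp : p ∈ S
    · obtain ⟨m, hm⟩ := (hS p hp).exists_pole <| by
        filter_upwards [eventually_notMem_finset S p] with x hx
          using (hpos x (by simpa using hx)).le
      exact ⟨m, fun _ => hm⟩
    · exact ⟨0, fun h => absurd h hp⟩
  choose m hm using hpole
  have hex : ∀ p : R3, ∃ h : R3 → ℝ, p ∈ S → HarmonicAt h p ∧
      h =ᶠ[𝓝[≠] p] fun x => φ x - m p * ‖x - p‖⁻¹ := by
    intro p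
    by_cases hp : p ∈ S
    · obtain ⟨h, hh⟩ := (hm p hp).2
      exact ⟨h, fun _ => hh⟩
    · exact ⟨0, fun h => absurd h hp⟩
  choose h hh using hex
  -- φ minus all its poles, with the value at each x ∈ S supplied by the local harmonic extension `h
  -- x`.
  let F : R3 → ℝ := fun x =>
    (if x ∈ S then h x x else φ x) - ∑ p ∈ S, m p * ‖x - p‖⁻¹
  have hterm : ∀ (p x : R3), x ≠ p → HarmonicAt (fun y => m p * ‖y - p‖⁻¹) x := fun p x hx =>
    (harmonicAt_inv_dist hx).const_smul (c := m p)
  have hF : HarmonicOnNhd F univ := by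
    intro x _
    by_cases hx : x ∈ S
    · have hG : HarmonicAt (fun y => h x y - ∑ p ∈ S.erase x, m p * ‖y - p‖⁻¹) x :=
        (hh x hx).1.sub (harmonicAt_sum fun p hp =>
          hterm p x (Finset.ne_of_mem_erase hp).symm)
      refine (harmonicAt_congr_nhds ?_).1 hG
      have hsplit : ∀ y, ∑ p ∈ S, m p * ‖y - p‖⁻¹
          = m x * ‖y - x‖⁻¹ + ∑ p ∈ S.erase x, m p * ‖y - p‖⁻¹ := fun y =>
        (Finset.add_sum_erase S _ hx).symm
      rw [EventuallyEq, ← nhdsNE_sup_pure, eventually_sup]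
      constructor
      · filter_upwards [(hh x hx).2, eventually_notMem_finset S x] with y hy hyS
        simp only [F, if_neg hyS, hy, hsplit]
        ring
      -- At the centre itself the convention 0⁻¹ = 0 removes the singular term from the sum.
      · rw [eventually_pure]
        simp only [F, if_pos hx, hsplit]
        simp
    · have hG : HarmonicAt (fun y => φ y - ∑ p ∈ S, m p * ‖y - p‖⁻¹) x :=
        (hφ x (by simpa using hx)).sub (harmonicAt_sum fun p hp =>
          hterm p x (by rintro rfl; exact hx hp))
      refine (harmonicAt_congr_nhds ?_).1 hG
      filter_upwards [S.finite_toSet.isClosed.isOpen_compl.mem_nhds (by simpa using hx)] with y hy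
      have hy : y ∉ S := by simpa using hy
      simp only [F, if_neg hy]
  -- Compactness handles a large ball. Outside it φ > 0 and every distance to S is at least 1, so F
  -- ≥ -∑ m p.
  have hFb : BddBelow (range F) := by
    obtain ⟨r, hr⟩ := S.finite_toSet.isBounded.exists_norm_le
    have hcb : BddBelow (F '' Metric.closedBall 0 (|r| + 1)) :=
      (isCompact_closedBall _ _).bddBelow_image (hF.continuousOn.mono (subset_univ _))
    obtain ⟨b, hb⟩ := hcb
    refine ⟨min b (-∑ p ∈ S, m p), ?_⟩
    rintro _ ⟨x, rfl⟩
    by_cases hx : x ∈ Metric.closedBall (0 : R3) (|r| + 1)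
    · exact (min_le_left _ _).trans (hb ⟨x, hx, rfl⟩)
    · refine (min_le_right _ _).trans ?_
      rw [mem_closedBall_zero_iff, not_le] at hx
      have hdist : ∀ p ∈ S, 1 ≤ ‖x - p‖ := fun p hp => by
        have h1 := hr p hp
        have h2 := norm_sub_norm_le x p
        have := le_abs_self r
        linarith
      have hxS : x ∉ S := fun h => by have := hdist x h; simp at this; linarith
      simp only [F, if_neg hxS]
      have h3 : ∑ p ∈ S, m p * ‖x - p‖⁻¹ ≤ ∑ p ∈ S, m p := Finset.sum_le_sum fun p hp =>
        mul_le_of_le_one_right (hm p hp).1.le (inv_le_one_of_one_le₀ (hdist p hp))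
      have h4 := hpos x (by simpa using hxS)
      linarith
  obtain ⟨c, hc⟩ := hF.eq_const hFb
  refine ⟨c, m, fun p hp => (hm p hp).1, fun x hx => ?_⟩
  have := hc x
  simp only [F, if_neg hx] at this
  linarith

end Bocher

/-! ### A mountain pass theorem by a single descent step. -/

section MountainPass

/-- A tube lemma for filters: it turns the local descent estimates into one step size valid on a
whole compact sublevel set. -/
theorem IsCompact.eventually_forall_mem_of_prod {α β : Type*} [TopologicalSpace α] {K : Set α}
    (hK : IsCompact K) {l : Filter β} {P : α → β → Prop}
    (h : ∀ x ∈ K, ∀ᶠ z in 𝓝 x ×ˢ l, P z.1 z.2) : ∀ᶠ s in l, ∀ x ∈ K, P x s := by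
  refine hK.induction_on (p := fun A => ∀ᶠ s in l, ∀ x ∈ A, P x s) (by simp)
    (fun A B hAB hB => hB.mono fun s hs x hx => hs x (hAB hx))
    (fun A B hA hB => (hA.and hB).mono fun s hs x hx => hx.elim (hs.1 x) (hs.2 x))
    fun x hx => ?_
  obtain ⟨A, hA, B, hB, hAB⟩ := Filter.mem_prod_iff.1 (h x hx)
  exact ⟨A, mem_nhdsWithin_of_mem_nhds hA, by
    filter_upwards [hB] with s hs x hx using hAB (mk_mem_prod hx hs)⟩

/-- Moving a little along a direction of descent decreases the function, locally uniformly. -/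
theorem eventually_lt_of_fderiv_neg {f : R3 → ℝ} {V : R3 → R3} {x₀ : R3} (hf : ContDiffAt ℝ 1 f x₀)
    (hV : ContinuousAt V x₀) (hneg : fderiv ℝ f x₀ (V x₀) < 0) :
    ∀ᶠ z : R3 × ℝ in 𝓝 x₀ ×ˢ 𝓝[>] 0, f (z.1 + z.2 • V z.1) < f z.1 := by
  -- Strict differentiability makes the error uniform in the base point. The linear term is below
  -- -(a/2)s and ε is chosen so that the error is at most (a/4)s.
  have hs : HasStrictFDerivAt f (fderiv ℝ f x₀) x₀ := hf.hasStrictFDerivAt (by norm_num)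
  set A := fderiv ℝ f x₀ with hA
  set a := -A (V x₀) with ha
  have ha0 : 0 < a := by linarith
  set ε := a / (4 * (‖V x₀‖ + 1)) with hε
  have hε0 : 0 < ε := by positivity
  have hle : 𝓝 x₀ ×ˢ 𝓝[>] (0 : ℝ) ≤ 𝓝 (x₀, 0) := by
    rw [nhds_prod_eq]; exact Filter.prod_mono le_rfl nhdsWithin_le_nhds
  have hV2 : ContinuousAt (fun z : R3 × ℝ => V z.1) (x₀, 0) :=
    ContinuousAt.comp (g := V) (f := Prod.fst) (x := (x₀, (0 : ℝ))) hV continuousAt_fst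
  have ht : Tendsto (fun z : R3 × ℝ => (z.1 + z.2 • V z.1, z.1)) (𝓝 (x₀, 0)) (𝓝 (x₀, x₀)) := by
    have : ContinuousAt (fun z : R3 × ℝ => (z.1 + z.2 • V z.1, z.1)) (x₀, 0) :=
      (continuousAt_fst.add (continuousAt_snd.smul hV2)).prodMk continuousAt_fst
    simpa [ContinuousAt] using this
  have h1 := ht.eventually (hs.isLittleO.def hε0)
  have h2 : ∀ᶠ z : R3 × ℝ in 𝓝 (x₀, 0), A (V z.1) < -(a / 2) := by
    have : ContinuousAt (fun z : R3 × ℝ => A (V z.1)) (x₀, 0) := A.continuous.continuousAt.comp hV2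
    refine this.eventually (gt_mem_nhds ?_)
    simp only; linarith
  have h3 : ∀ᶠ z : R3 × ℝ in 𝓝 (x₀, 0), ‖V z.1‖ < ‖V x₀‖ + 1 :=
    hV2.norm.eventually (gt_mem_nhds (by simp))
  have h4 : ∀ᶠ z : R3 × ℝ in 𝓝 x₀ ×ˢ 𝓝[>] 0, 0 < z.2 :=
    (tendsto_snd (f := 𝓝 x₀) (g := 𝓝[>] (0 : ℝ))).eventually self_mem_nhdsWithin
  filter_upwards [hle h1, hle h2, hle h3, h4] with z h1 h2 h3 h4
  simp only [add_sub_cancel_left, map_smul, smul_eq_mul, norm_smul, Real.norm_eq_abs,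
    abs_of_pos h4] at h1
  have h5 := (abs_le.1 h1).2
  have h6 : ε * (z.2 * ‖V z.1‖) ≤ z.2 * (a / 4) := by
    calc ε * (z.2 * ‖V z.1‖) ≤ ε * (z.2 * (‖V x₀‖ + 1)) := by gcongr
      _ = z.2 * (a / 4) := by rw [hε]; field_simp
  have h7 : z.2 * A (V z.1) < z.2 * -(a / 2) := mul_lt_mul_of_pos_left h2 h4
  have h8 : 0 < z.2 * (a / 4) := by positivity
  linarith

/-- A small sphere about p₁ misses S and separates p₁ from p₂, so every connected set joining them
meets it; β is the positive minimum of f there. -/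
theorem exists_pos_separating_level {f : R3 → ℝ} {S : Finset R3} (hc : Continuous f)
    (hnn : ∀ x, 0 ≤ f x) (hz : ∀ x, f x = 0 ↔ x ∈ S) {p₁ p₂ : R3} (hne : p₁ ≠ p₂) :
    ∃ β, 0 < β ∧ ∀ C : Set R3, IsPreconnected C → p₁ ∈ C → p₂ ∈ C → ∃ x ∈ C, β ≤ f x := by
  obtain ⟨r, hr, hr2, hrS⟩ : ∃ r, 0 < r ∧ r < ‖p₂ - p₁‖ ∧ ∀ x, ‖x - p₁‖ = r → x ∉ S := by
    have h1 := eventually_notMem_finset S p₁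
    obtain ⟨ε, hε, hball⟩ := Metric.mem_nhdsWithin_iff.1 h1
    have hpos : 0 < ‖p₂ - p₁‖ := norm_pos_iff.2 (sub_ne_zero.2 hne.symm)
    refine ⟨min ε ‖p₂ - p₁‖ / 2, by positivity, ?_, fun x hx => hball ⟨?_, ?_⟩⟩
    · have := min_le_right ε ‖p₂ - p₁‖; linarith
    · rw [Metric.mem_ball, dist_eq_norm, hx]
      have := min_le_left ε ‖p₂ - p₁‖; linarith
    · rintro rfl
      rw [sub_self, norm_zero] at hx
      have : 0 < min ε ‖p₂ - x‖ := by positivity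
      linarith
  obtain ⟨y, hy⟩ := exists_norm_sub_eq p₁ hr.le
  obtain ⟨z, hzm, hzmin⟩ := (isCompact_sphere p₁ r).exists_isMinOn ⟨y, mem_sphere_iff_norm.2 hy⟩
    hc.continuousOn
  refine ⟨f z, ?_, fun C hC h1 h2 => ?_⟩
  · refine lt_of_le_of_ne (hnn z) fun h => hrS z (mem_sphere_iff_norm.1 hzm) ((hz z).1 h.symm)
  · have hiv := hC.intermediate_value h1 h2
      (f := fun x => ‖x - p₁‖) (by fun_prop)
    obtain ⟨x, hx, hxr⟩ := hiv (show r ∈ Icc _ _ by simp [hr.le, hr2.le])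
    exact ⟨x, hx, hzmin (mem_sphere_iff_norm.2 hxr)⟩

/-- The mountain pass theorem for a proper nonnegative function on `ℝ³` with at least two zeros,
finite in number, and differentiable away from them. -/
theorem exists_fderiv_eq_zero_of_two_zeros {f : R3 → ℝ} {S : Finset R3} (hc : Continuous f)
    (hnn : ∀ x, 0 ≤ f x) (hz : ∀ x, f x = 0 ↔ x ∈ S) (hprop : ∀ b, IsCompact {x | f x ≤ b})
    (hd : ∀ x, x ∉ S → ContDiffAt ℝ 1 f x) (hS : 2 ≤ S.card) :
    ∃ q, q ∉ S ∧ fderiv ℝ f q = 0 := by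
  by_contra! hcrit
  obtain ⟨p₁, hp₁, p₂, hp₂, hne⟩ := Finset.one_lt_card.1 (show 1 < S.card by omega)
  obtain ⟨β, hβ, hsep⟩ := exists_pos_separating_level hc hnn hz hne
  -- The min-max runs over preconnected sets instead of paths; continuous images of such sets are
  -- again preconnected, which is all the deformation needs.
  let B : Set ℝ := {b | ∃ C : Set R3, IsPreconnected C ∧ p₁ ∈ C ∧ p₂ ∈ C ∧ ∀ x ∈ C, f x ≤ b}
  have hBβ : ∀ b ∈ B, β ≤ b := by
    rintro b ⟨C, hC, h1, h2, hb⟩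
    obtain ⟨x, hx, hxβ⟩ := hsep C hC h1 h2
    exact hxβ.trans (hb x hx)
  have hBne : B.Nonempty := by
    have hK : IsCompact (segment ℝ p₁ p₂) := by
      rw [segment_eq_image]
      exact isCompact_Icc.image (by fun_prop)
    obtain ⟨b, hb⟩ := hK.bddAbove_image hc.continuousOn
    exact ⟨b, segment ℝ p₁ p₂, (convex_segment p₁ p₂).isPreconnected, left_mem_segment _ _ _,
      right_mem_segment _ _ _, fun x hx => hb ⟨x, hx, rfl⟩⟩
  have hBbd : BddBelow B := ⟨β, hBβ⟩
  set b := sInf B with hb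
  have hbβ : β ≤ b := le_csInf hBne hBβ
  have hb0 : 0 < b := hβ.trans_le hbβ
  -- Descent field cut off below level b/2: it vanishes near S, where f need not be differentiable,
  -- so it is continuous and fixes p₁ and p₂.
  let V : R3 → R3 := fun x => (-max 0 (f x - b / 2)) • gradient f x
  have hVz : ∀ x, f x ≤ b / 2 → V x = 0 := fun x hx => by
    simp only [V, max_eq_left (sub_nonpos.2 hx), neg_zero, zero_smul]
  have hVS : ∀ x ∈ S, V x = 0 := fun x hx => hVz x (by rw [(hz x).2 hx]; positivity)
  have hVc : Continuous V := by
    refine continuous_iff_continuousAt.2 fun x => ?_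
    by_cases hx : x ∈ S
    · have h1 : ∀ᶠ y in 𝓝 x, f y < b / 2 :=
        hc.continuousAt.eventually (gt_mem_nhds (by rw [(hz x).2 hx]; positivity))
      have h2 : V =ᶠ[𝓝 x] fun _ => 0 := by
        filter_upwards [h1] with y hy using hVz y hy.le
      exact continuousAt_const.congr h2.symm
    · have h1 : ContinuousAt (fderiv ℝ f) x :=
        ((hd x hx).fderiv_right (m := 0) (by norm_num)).continuousAt
      have h2 : ContinuousAt (gradient f) x :=
        (InnerProductSpace.toDual ℝ R3).symm.continuous.continuousAt.comp h1
      have h3 : Continuous fun x => -max 0 (f x - b / 2) := by fun_prop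
      exact h3.continuousAt.smul h2
  have hVneg : ∀ x, f x = b → fderiv ℝ f x (V x) < 0 := by
    intro x hx
    have hxS : x ∉ S := fun h => by rw [(hz x).2 h] at hx; linarith
    have hg : gradient f x ≠ 0 := fun h => hcrit x hxS <| by
      have := congrArg (InnerProductSpace.toDual ℝ R3) h
      simpa [gradient] using this
    have h1 : fderiv ℝ f x (gradient f x) = ‖gradient f x‖ ^ 2 := by
      have : fderiv ℝ f x = InnerProductSpace.toDual ℝ R3 (gradient f x) := by simp [gradient]
      rw [this, InnerProductSpace.toDual_apply_apply, real_inner_self_eq_norm_sq]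
    have h2 : max 0 (f x - b / 2) = b / 2 := by
      rw [hx]; rw [max_eq_right (by linarith)]; ring
    simp only [V, map_smul, h1, h2, smul_eq_mul]
    have := norm_pos_iff.2 hg
    have : 0 < b / 2 * ‖gradient f x‖ ^ 2 := by positivity
    linarith
  have hpush : ∀ᶠ s : ℝ in 𝓝[>] 0, ∀ x ∈ {x | f x ≤ b}, f (x + s • V x) < b := by
    refine (hprop b).eventually_forall_mem_of_prod (P := fun x s => f x ≤ b → f (x + s • V x) < b)
      (fun x hx => ?_) |>.mono fun s hs x hx => hs x hx hx
    rcases lt_or_eq_of_le (show f x ≤ b from hx) with hlt | heq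
    · have hcont : Continuous fun z : R3 × ℝ => f (z.1 + z.2 • V z.1) := by fun_prop
      have h1 : ∀ᶠ z : R3 × ℝ in 𝓝 (x, 0), f (z.1 + z.2 • V z.1) < b :=
        hcont.continuousAt.eventually (gt_mem_nhds (by simpa using hlt))
      have hle : 𝓝 x ×ˢ 𝓝[>] (0 : ℝ) ≤ 𝓝 (x, 0) := by
        rw [nhds_prod_eq]; exact Filter.prod_mono le_rfl nhdsWithin_le_nhds
      filter_upwards [hle h1] with z hz _ using hz
    · have hxS : x ∉ S := fun h => by rw [(hz x).2 h] at heq; linarith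
      filter_upwards [eventually_lt_of_fderiv_neg (hd x hxS) hVc.continuousAt (hVneg x heq)]
        with z hz hzb using hz.trans_le hzb
  obtain ⟨s, hs⟩ := hpush.exists
  let T : R3 → R3 := fun x => x + s • V x
  have hT : Continuous T := by fun_prop
  have hTS : ∀ x ∈ S, T x = x := fun x hx => by simp [T, hVS x hx]
  -- The points of {f ≤ b + 1} that T fails to push below b form a compact set on which f > b; δ is
  -- taken below the resulting gap.
  obtain ⟨δ, hδ, hTδ⟩ : ∃ δ, 0 < δ ∧ ∀ x, f x ≤ b + δ → f (T x) < b := by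
    have hK : IsCompact ({x | f x ≤ b + 1} ∩ {x | b ≤ f (T x)}) :=
      (hprop _).inter_right (isClosed_le continuous_const (hc.comp hT))
    rcases ({x | f x ≤ b + 1} ∩ {x | b ≤ f (T x)}).eq_empty_or_nonempty with he | hne
    · refine ⟨1, one_pos, fun x hx => ?_⟩
      by_contra! h
      have : x ∈ ({x | f x ≤ b + 1} ∩ {x | b ≤ f (T x)}) := ⟨hx, h⟩
      rw [he] at this
      exact this
    · obtain ⟨z, hzm, hzmin⟩ := hK.exists_isMinOn hne hc.continuousOn
      have hzb : b < f z := by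
        by_contra! h
        exact absurd (hs z h) (not_lt.2 hzm.2)
      refine ⟨min 1 ((f z - b) / 2), lt_min one_pos (by linarith), fun x hx => ?_⟩
      by_contra! h
      have h1 := min_le_left 1 ((f z - b) / 2)
      have h2 := min_le_right 1 ((f z - b) / 2)
      have h3 : f z ≤ f x := hzmin ⟨show f x ≤ b + 1 by linarith, h⟩
      linarith
  obtain ⟨b', ⟨C, hC, h1, h2, hCb⟩, hb'⟩ := exists_lt_of_csInf_lt hBne
    (show sInf B < b + δ by linarith)
  have hKne : {x | f x ≤ b + δ}.Nonempty := ⟨p₁, (hCb p₁ h1).trans hb'.le⟩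
  -- The supremum of f ∘ T over the sublevel set is attained, hence strictly below b, and it is an
  -- admissible level for T '' C: this contradicts b = inf B.
  obtain ⟨z, hzm, hzmax⟩ := (hprop (b + δ)).exists_isMaxOn hKne (hc.comp hT).continuousOn
  have hmem : f (T z) ∈ B := by
    refine ⟨T '' C, hC.image T hT.continuousOn, ⟨p₁, h1, hTS _ hp₁⟩, ⟨p₂, h2, hTS _ hp₂⟩, ?_⟩
    rintro _ ⟨x, hx, rfl⟩
    exact hzmax (show f x ≤ b + δ from (hCb x hx).trans hb'.le)
  have h3 := csInf_le hBbd hmem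
  have h4 := hTδ z hzm
  linarith

end MountainPass

/-! ### Critical points of a potential of positive point masses. -/

section Potential

variable {S : Finset R3} {m : R3 → ℝ}

/-- The multi-centre potential with masses `m p` at the points `p ∈ S`. -/
noncomputable def multiPotential (S : Finset R3) (m : R3 → ℝ) (x : R3) : ℝ :=
  ∑ p ∈ S, m p * ‖x - p‖⁻¹

theorem multiPotential_pos (hm : ∀ p ∈ S, 0 < m p) (hS : S.Nonempty) {x : R3} (hx : x ∉ S) :
    0 < multiPotential S m x :=
  Finset.sum_pos (fun p hp => mul_pos (hm p hp) (inv_pos.2 (norm_pos_iff.2 (sub_ne_zero.2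
    (by rintro rfl; exact hx hp))))) hS

theorem contDiffAt_multiPotential {x : R3} (hx : x ∉ S) {n : WithTop ℕ∞} :
    ContDiffAt ℝ n (multiPotential S m) x :=
  ContDiffAt.sum fun p hp => contDiffAt_const.mul
    (contDiffAt_inv_dist (by rintro rfl; exact hx hp))

/-- The potential of at least two positive point masses has a critical point. -/
theorem exists_fderiv_multiPotential_eq_zero (hm : ∀ p ∈ S, 0 < m p) (hS : 2 ≤ S.card) :
    ∃ q, q ∉ S ∧ fderiv ℝ (multiPotential S m) q = 0 := by
  classical
  have hSne : S.Nonempty := Finset.card_pos.1 (by omega)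
  -- The additive constant c is left out on purpose: 1/(c + V) with c > 0 is bounded and so not
  -- proper, whereas 1/V is proper.
  let f : R3 → ℝ := fun x => if x ∈ S then 0 else (multiPotential S m x)⁻¹
  have hnn : ∀ x, 0 ≤ f x := fun x => by
    simp only [f]; split_ifs with h
    · exact le_rfl
    · exact (inv_pos.2 (multiPotential_pos hm hSne h)).le
  have hz : ∀ x, f x = 0 ↔ x ∈ S := fun x => by
    simp only [f]; split_ifs with h
    · simp [h]
    · simp [h, (multiPotential_pos hm hSne h).ne']
  have hev : ∀ x, x ∉ S → f =ᶠ[𝓝 x] fun y => (multiPotential S m y)⁻¹ := fun x hx => by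
    filter_upwards [S.finite_toSet.isClosed.isOpen_compl.mem_nhds (by simpa using hx)] with y hy
    exact if_neg (by simpa using hy)
  have hd : ∀ x, x ∉ S → ContDiffAt ℝ 1 f x := fun x hx =>
    ((contDiffAt_multiPotential hx).inv (multiPotential_pos hm hSne hx).ne').congr_of_eventuallyEq
      (hev x hx)
  have hc : Continuous f := by
    refine continuous_iff_continuousAt.2 fun p => ?_
    by_cases hp : p ∈ S
    · have hfp : f p = 0 := (hz p).2 hp
      have hle : ∀ x, f x ≤ (m p)⁻¹ * ‖x - p‖ := fun x => by
        by_cases hx : x ∈ S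
        · rw [(hz x).2 hx]; have := hm p hp; positivity
        · have hxp : 0 < ‖x - p‖ := norm_pos_iff.2 (sub_ne_zero.2 (by rintro rfl; exact hx hp))
          have h1 : m p * ‖x - p‖⁻¹ ≤ multiPotential S m x :=
            Finset.single_le_sum (f := fun p => m p * ‖x - p‖⁻¹)
              (fun q hq => mul_nonneg (hm q hq).le (by positivity)) hp
          have h2 := mul_pos (hm p hp) (inv_pos.2 hxp)
          have h3 := inv_anti₀ h2 h1
          simpa [f, hx, mul_comm] using h3
      rw [ContinuousAt, hfp]
      refine squeeze_zero hnn hle ?_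
      have : Continuous fun x : R3 => (m p)⁻¹ * ‖x - p‖ := by fun_prop
      simpa using this.tendsto p
    · exact (hd p hp).continuousAt
  have hprop : ∀ b, IsCompact {x | f x ≤ b} := by
    intro b
    obtain ⟨r, hr⟩ := S.finite_toSet.isBounded.exists_norm_le
    set M := ∑ p ∈ S, m p with hM
    have hM0 : 0 < M := Finset.sum_pos hm hSne
    refine (isCompact_closedBall (0 : R3) (r + |b| * M + M)).of_isClosed_subset
      (isClosed_le hc continuous_const) fun x hx => ?_
    rw [mem_closedBall_zero_iff]
    by_contra! hlt
    -- At distance at least d from S the potential is at most M/d = 1/(|b| + 1), so f ≥ |b| + 1 > b.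
    set d := |b| * M + M with hd
    have hd0 : 0 < d := by positivity
    have hdist : ∀ p ∈ S, d ≤ ‖x - p‖ := fun p hp => by
      have h1 := hr p hp
      have h2 := norm_sub_norm_le x p
      linarith
    have hxS : x ∉ S := fun h => by have := hdist x h; simp at this; linarith
    have h1 : multiPotential S m x ≤ M * d⁻¹ := by
      rw [hM, Finset.sum_mul]
      exact Finset.sum_le_sum fun p hp =>
        mul_le_mul_of_nonneg_left (inv_anti₀ hd0 (hdist p hp)) (hm p hp).le
    have h2 : (M * d⁻¹)⁻¹ ≤ f x := by
      simp only [f, if_neg hxS]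
      exact inv_anti₀ (multiPotential_pos hm hSne hxS) h1
    have h3 : (M * d⁻¹)⁻¹ = |b| + 1 := by rw [hd]; field_simp
    have h4 : f x ≤ b := hx
    have := le_abs_self b
    linarith
  obtain ⟨q, hq, hq0⟩ := exists_fderiv_eq_zero_of_two_zeros hc hnn hz hprop hd hS
  refine ⟨q, hq, ?_⟩
  have hpos := multiPotential_pos hm hSne hq
  have hdq := ((contDiffAt_multiPotential (m := m) (n := 1) hq).differentiableAt (by norm_num))
  have e : (fun y => (f y)⁻¹) =ᶠ[𝓝 q] multiPotential S m := by
    filter_upwards [hev q hq] with y hy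
    rw [hy, inv_inv]
  have hfq : HasFDerivAt f (0 : R3 →L[ℝ] ℝ) q :=
    hq0 ▸ ((hd q hq).differentiableAt (by norm_num)).hasFDerivAt
  have hne : f q ≠ 0 := fun h => hq ((hz q).1 h)
  have h5 := (hasDerivAt_inv hne).comp_hasFDerivAt q hfq
  rw [smul_zero] at h5
  rw [← e.fderiv_eq]
  exact h5.fderiv

end Potential

/-- A positive harmonic function on the complement of at least two genuine singularities has a
critical point. -/
theorem exists_fderiv_eq_zero_of_isolatedSingularities {φ : R3 → ℝ} {S : Finset R3}
    (hφ : HarmonicOnNhd φ (↑S : Set R3)ᶜ) (hpos : ∀ q ∈ (↑S : Set R3)ᶜ, 0 < φ q)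
    (hS : ∀ p ∈ S, HasIsolatedSingularityAt φ p) (hk : 2 ≤ S.card) :
    ∃ q ∈ (↑S : Set R3)ᶜ, fderiv ℝ φ q = 0 := by
  obtain ⟨c, m, hm, hφm⟩ := exists_eq_const_add_sum_inv_dist hφ hpos hS
  obtain ⟨q, hq, hq0⟩ := exists_fderiv_multiPotential_eq_zero hm hk
  have hq' : q ∈ (↑S : Set R3)ᶜ := by simpa using hq
  refine ⟨q, hq', ?_⟩
  have e : φ =ᶠ[𝓝 q] fun x => c + multiPotential S m x := by
    filter_upwards [S.finite_toSet.isClosed.isOpen_compl.mem_nhds hq'] with y hy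
    exact hφm y (by simpa using hy)
  rw [e.fderiv_eq, fderiv_const_add, hq0]

/-! ### The geodesic equation in coordinates for a fibration-type metric. -/

section GeodesicCalculus

variable {E F : Type*} [NormedAddCommGroup E] [NormedSpace ℝ E] [NormedAddCommGroup F]
  [InnerProductSpace ℝ F]

/-- If a metric has the form `f α² + P ⟨Dm, Dm⟩` with `f`, `P` critical at `c t`, then a curve `c`
in a fibre of `m` with `α(c') = 1` and `dα(c', ·) = 0` satisfies the geodesic equation. -/
theorem geodesic_equation_of_fibration {G : E → E → E → ℝ} {f P : E → ℝ} {α : E → E →L[ℝ] ℝ}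
    {m : E → F} {c : ℝ → E} {t : ℝ}
    (hG : ∀ᶠ y in 𝓝 (c t), ∀ u v, G y u v
      = f y * (α y u * α y v) + P y * inner ℝ (fderiv ℝ m y u) (fderiv ℝ m y v))
    (hf : HasFDerivAt f (0 : E →L[ℝ] ℝ) (c t)) (hP : HasFDerivAt P (0 : E →L[ℝ] ℝ) (c t))
    (hα : DifferentiableAt ℝ α (c t)) (hm : ContDiffAt ℝ 2 m (c t)) (hc : ContDiffAt ℝ 2 c t)
    (hαc : ∀ᶠ s in 𝓝 t, α (c s) (deriv c s) = 1)
    (hmc : ∀ᶠ s in 𝓝 t, fderiv ℝ m (c s) (deriv c s) = 0)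
    (hcurv : ∀ v, fderiv ℝ α (c t) (deriv c t) v = fderiv ℝ α (c t) v (deriv c t)) (v : E) :
    G (c t) (deriv (deriv c) t) v
      + (1 / 2) * (fderiv ℝ (fun z => G z (deriv c t) v) (c t) (deriv c t)
      + fderiv ℝ (fun z => G z (deriv c t) v) (c t) (deriv c t)
      - fderiv ℝ (fun z => G z (deriv c t) (deriv c t)) (c t) v) = 0 := by
  set y := c t with hy
  set ξ := deriv c t with hξ
  set A := fderiv ℝ α y with hA
  have hAd : HasFDerivAt α A y := hα.hasFDerivAt
  have hDm : DifferentiableAt ℝ (fderiv ℝ m) y :=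
    (hm.fderiv_right (m := 1) (by norm_num)).differentiableAt (by norm_num)
  set B := fderiv ℝ (fderiv ℝ m) y with hB
  have hBd : HasFDerivAt (fderiv ℝ m) B y := hDm.hasFDerivAt
  have hc1 : HasDerivAt c ξ t := (hc.differentiableAt (by norm_num)).hasDerivAt
  have hc2 : HasDerivAt (deriv c) (deriv (deriv c) t) t := by
    have h1 : ContDiffAt ℝ 1 (fderiv ℝ c) t := hc.fderiv_right (by norm_num)
    have h2 : DifferentiableAt ℝ (fun s => fderiv ℝ c s 1) t :=
      (h1.differentiableAt (by norm_num)).clm_apply (differentiableAt_const _)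
    exact h2.hasDerivAt
  have hα1 : α y ξ = 1 := hαc.self_of_nhds
  have hm0 : fderiv ℝ m y ξ = 0 := hmc.self_of_nhds
  -- Differentiating α(c') = 1, and below Dm(c') = 0, along the curve expresses the components of
  -- c'' through first derivatives of α and Dm.
  have hα2 : A ξ ξ + α y (deriv (deriv c) t) = 0 := by
    have h1 : HasDerivAt (fun s => α (c s) (deriv c s)) (A ξ ξ + α y (deriv (deriv c) t)) t :=
      (hAd.comp_hasDerivAt t hc1).clm_apply hc2
    have h2 : HasDerivAt (fun s => α (c s) (deriv c s)) 0 t :=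
      (hasDerivAt_const t (1 : ℝ)).congr_of_eventuallyEq hαc
    exact h1.unique h2
  have hm2 : B ξ ξ + fderiv ℝ m y (deriv (deriv c) t) = 0 := by
    have h1 : HasDerivAt (fun s => fderiv ℝ m (c s) (deriv c s))
        (B ξ ξ + fderiv ℝ m y (deriv (deriv c) t)) t :=
      (hBd.comp_hasDerivAt t hc1).clm_apply hc2
    have h2 : HasDerivAt (fun s => fderiv ℝ m (c s) (deriv c s)) 0 t :=
      (hasDerivAt_const t (0 : F)).congr_of_eventuallyEq hmc
    exact h1.unique h2
  have hGd : ∀ u w z, fderiv ℝ (fun x => G x u w) y z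
      = f y * (A z u * α y w + α y u * A z w) + P y * (inner ℝ (B z u) (fderiv ℝ m y w)
        + inner ℝ (fderiv ℝ m y u) (B z w)) := by
    intro u w z
    have hau := hAd.clm_apply (hasFDerivAt_const u y)
    have haw := hAd.clm_apply (hasFDerivAt_const w y)
    have hbu := hBd.clm_apply (hasFDerivAt_const u y)
    have hbw := hBd.clm_apply (hasFDerivAt_const w y)
    have h1 := (hf.mul (hau.mul haw)).add (hP.mul (hbu.inner ℝ hbw))
    have h2 := h1.congr_of_eventuallyEq (f₁ := fun x => G x u w)
      (by filter_upwards [hG] with x hx using hx u w)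
    rw [h2.fderiv]
    simp
    ring
  -- The terms in A ξ ξ and B ξ ξ cancel against those from c''. What remains is f (A ξ v - A v ξ) =
  -- f dα(ξ, v), which vanishes by `hcurv`.
  rw [hG.self_of_nhds, hGd, hGd, hm0, hα1, hcurv v]
  have e1 : fderiv ℝ m y (deriv (deriv c) t) = -B ξ ξ := eq_neg_of_add_eq_zero_right hm2
  have e2 : α y (deriv (deriv c) t) = -A ξ ξ := eq_neg_of_add_eq_zero_right hα2
  rw [e1, e2, inner_neg_left]
  simp
  ring

end GeodesicCalculus

/-! ### Smoothness of coordinate vector fields and of metric coefficients. -/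

section BundleSections

variable {X : Type*} [TopologicalSpace X] [ChartedSpace R4 X] [IsManifold (𝓡 4) ∞ X]

theorem contMDiffAt_extChartAt_symm {x₀ : X} {y : R4} (hy : y ∈ (extChartAt (𝓡 4) x₀).target) :
    ContMDiffAt 𝓘(ℝ, R4) (𝓡 4) ∞ (extChartAt (𝓡 4) x₀).symm y :=
  (contMDiffOn_extChartAt_symm x₀).contMDiffAt ((isOpen_extChartAt_target x₀).mem_nhds hy)

/-- Coordinate vector fields are smooth. -/
theorem contMDiffOn_coordVec (x₀ : X) (v : R4) :
    ContMDiffOn 𝓘(ℝ, R4) (𝓡 4).tangent ∞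
      (fun y => (⟨(extChartAt (𝓡 4) x₀).symm y, coordVec x₀ y v⟩ : TangentBundle (𝓡 4) X))
      (extChartAt (𝓡 4) x₀).target := by
  have ho := isOpen_extChartAt_target (I := 𝓡 4) x₀
  have h1 : ContMDiffOn 𝓘(ℝ, R4) (𝓡 4) ∞ (extChartAt (𝓡 4) x₀).symm (extChartAt (𝓡 4) x₀).target :=
    contMDiffOn_extChartAt_symm x₀
  have h2 := h1.contMDiffOn_tangentMapWithin (m := ∞) (by simp) ho.uniqueMDiffOn
  have h3 : ContMDiffOn 𝓘(ℝ, R4) 𝓘(ℝ, R4).tangent ∞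
      (fun y => (⟨y, v⟩ : TangentBundle 𝓘(ℝ, R4) R4)) (extChartAt (𝓡 4) x₀).target := fun y _ =>
    contMDiffWithinAt_vectorSpace_iff_contDiffWithinAt.2 contDiffWithinAt_const
  refine (h2.comp h3 fun y hy => hy).congr fun y hy => ?_
  simp only [Function.comp_apply, tangentMapWithin, coordVec]
  rw [mfderivWithin_of_isOpen ho hy]

theorem contDiffAt_metric_apply (g : Metric4 X) {b : R4 → X}
    {σ τ : ∀ y, TangentSpace (𝓡 4) (b y)} {y : R4}
    (hσ : ContMDiffAt 𝓘(ℝ, R4) (𝓡 4).tangent ∞ (fun y => (⟨b y, σ y⟩ : TangentBundle (𝓡 4) X)) y)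
    (hτ : ContMDiffAt 𝓘(ℝ, R4) (𝓡 4).tangent ∞ (fun y => (⟨b y, τ y⟩ : TangentBundle (𝓡 4) X)) y) :
    ContDiffAt ℝ ∞ (fun y => g.inner (b y) (σ y) (τ y)) y := by
  have hb : ContMDiffAt 𝓘(ℝ, R4) (𝓡 4) ∞ b y := by
    have := hσ
    rw [Bundle.contMDiffAt_totalSpace] at this
    exact this.1
  have h : ContMDiffAt 𝓘(ℝ, R4) ((𝓡 4).prod 𝓘(ℝ)) ∞ (fun y => Bundle.TotalSpace.mk' ℝ
      (E := Bundle.Trivial X ℝ) (b y) (g.inner (b y) (σ y) (τ y))) y := by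
    apply ContMDiffAt.clm_bundle_apply₂ (F₁ := R4) (F₂ := R4)
    · exact ContMDiffAt.comp y g.contMDiff.contMDiffAt hb
    · exact hσ
    · exact hτ
  rw [Bundle.contMDiffAt_totalSpace] at h
  exact h.2.contDiffAt

end BundleSections

/-! ### The generator of the circle action and velocities of its orbits. -/

section CircleAction

theorem circleExp_smul_add {X : Type*} [MulAction Circle X] (s t : ℝ) (x : X) :
    Circle.exp (s + t) • x = Circle.exp s • Circle.exp t • x := by
  rw [Circle.exp_add, mul_smul]

variable {X : Type*} [TopologicalSpace X] [ChartedSpace R4 X] [MulAction Circle X]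

theorem contMDiff_circleExp_smul
    (hA : ContMDiff ((𝓡 1).prod (𝓡 4)) (𝓡 4) ∞ (fun p : Circle × X => p.1 • p.2)) :
    ContMDiff (𝓘(ℝ, ℝ).prod (𝓡 4)) (𝓡 4) ∞ (fun p : ℝ × X => Circle.exp p.1 • p.2) :=
  hA.comp ((contMDiff_circleExp.comp contMDiff_fst).prodMk contMDiff_snd)

theorem contMDiff_orbit
    (hA : ContMDiff ((𝓡 1).prod (𝓡 4)) (𝓡 4) ∞ (fun p : Circle × X => p.1 • p.2)) (x : X) :
    ContMDiff 𝓘(ℝ, ℝ) (𝓡 4) ∞ (fun t : ℝ => Circle.exp t • x) :=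
  (contMDiff_circleExp_smul hA).comp (contMDiff_id.prodMk contMDiff_const)

/-- The generator of a smooth circle action is a smooth vector field. -/
theorem contMDiff_circleGenerator [IsManifold (𝓡 4) ∞ X]
    (hA : ContMDiff ((𝓡 1).prod (𝓡 4)) (𝓡 4) ∞ (fun p : Circle × X => p.1 • p.2)) :
    ContMDiff (𝓡 4) (𝓡 4).tangent ∞
      (fun x => (⟨x, circleGenerator x⟩ : TangentBundle (𝓡 4) X)) := by
  have hB := contMDiff_circleExp_smul hA
  -- The generator is the tangent map of (t, x) ↦ e^{it} • x applied to the pair (∂ₜ at 0, zero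
  -- vector at x), a composition of smooth maps.
  let f1 : X → TangentBundle 𝓘(ℝ, ℝ) ℝ := fun _ => ⟨0, (1 : ℝ)⟩
  let f2 : X → TangentBundle (𝓡 4) X := fun x => ⟨x, 0⟩
  have h1 : ContMDiff (𝓡 4) 𝓘(ℝ, ℝ).tangent ∞ f1 := contMDiff_const
  have h2 : ContMDiff (𝓡 4) (𝓡 4).tangent ∞ f2 := Bundle.contMDiff_zeroSection _ _
  have h3 : ContMDiff (𝓘(ℝ, ℝ).tangent.prod (𝓡 4).tangent) (𝓘(ℝ, ℝ).prod (𝓡 4)).tangent ∞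
      (equivTangentBundleProd 𝓘(ℝ, ℝ) ℝ (𝓡 4) X).symm := contMDiff_equivTangentBundleProd_symm
  have h4 := (hB.contMDiff_tangentMap (m := ∞) (by simp)).comp (h3.comp (h1.prodMk h2))
  refine h4.congr fun x => ?_
  have hd : MDifferentiableAt (𝓘(ℝ, ℝ).prod (𝓡 4)) (𝓡 4)
      (fun p : ℝ × X => Circle.exp p.1 • p.2) (0, x) := hB.mdifferentiable (by simp) _
  have hι : HasMFDerivAt 𝓘(ℝ, ℝ) (𝓘(ℝ, ℝ).prod (𝓡 4)) (fun t : ℝ => (t, x)) 0 _ :=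
    (hasMFDerivAt_id (I := 𝓘(ℝ, ℝ)) (0 : ℝ)).prodMk (hasMFDerivAt_const x (0 : ℝ))
  have hc := (hd.hasMFDerivAt.comp (0 : ℝ) hι).mfderiv
  have h0 : Circle.exp 0 • x = x := by simp
  have e : (circleGenerator x : R4) = mfderiv (𝓘(ℝ, ℝ).prod (𝓡 4)) (𝓡 4)
      (fun p : ℝ × X => Circle.exp p.1 • p.2) (0, x) ((1 : ℝ), (0 : R4)) :=
    congrArg (fun L : ℝ →L[ℝ] R4 => L 1) hc
  have key : ∀ (a b : X) (v : R4), a = b →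
      (⟨a, v⟩ : TangentBundle (𝓡 4) X) = ⟨b, v⟩ := fun a b v h => by rw [h]
  refine (congrArg (fun v : R4 => (⟨x, v⟩ : TangentBundle (𝓡 4) X)) e).trans ?_
  exact key _ _ _ h0.symm

/-- The group law turns the orbit of x at time s + t into the orbit of e^{it} • x at time s, so the
velocity at t is the generator there. -/
theorem mfderiv_orbit
    (hA : ContMDiff ((𝓡 1).prod (𝓡 4)) (𝓡 4) ∞ (fun p : Circle × X => p.1 • p.2)) (x : X) (t : ℝ) :
    (mfderiv 𝓘(ℝ, ℝ) (𝓡 4) (fun t : ℝ => Circle.exp t • x) t (1 : ℝ) : R4)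
      = circleGenerator (Circle.exp t • x) := by
  have hγ : MDifferentiableAt 𝓘(ℝ, ℝ) (𝓡 4) (fun t : ℝ => Circle.exp t • x) (0 + t) :=
    (contMDiff_orbit hA x).mdifferentiable (by simp) _
  have hs : HasMFDerivAt 𝓘(ℝ, ℝ) 𝓘(ℝ, ℝ) (fun s : ℝ => s + t) 0 (ContinuousLinearMap.id ℝ ℝ) :=
    ((hasFDerivAt_id (0 : ℝ)).add_const t).hasMFDerivAt
  have h := hγ.hasMFDerivAt.comp 0 hs
  have e : (fun t : ℝ => Circle.exp t • x) ∘ (fun s : ℝ => s + t)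
      = fun s : ℝ => Circle.exp s • (Circle.exp t • x) := funext fun s => circleExp_smul_add s t x
  have h1 := congrArg (fun L : ℝ →L[ℝ] R4 => L 1) h.mfderiv
  have h2 : (circleGenerator (Circle.exp t • x) : R4)
      = mfderiv 𝓘(ℝ, ℝ) (𝓡 4) (fun t : ℝ => Circle.exp t • x) (0 + t) (1 : ℝ) := by
    rw [circleGenerator, ← e]
    exact h1
  have key : ∀ a b : ℝ, a = b →
    (mfderiv 𝓘(ℝ, ℝ) (𝓡 4) (fun t : ℝ => Circle.exp t • x) a (1 : ℝ) : R4)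
    = (mfderiv 𝓘(ℝ, ℝ) (𝓡 4) (fun t : ℝ => Circle.exp t • x) b (1 : ℝ) : R4) :=
    fun a b h => by rw [h]
  exact (key _ _ (zero_add t).symm).trans h2.symm

end CircleAction

/-! ### Orbits over critical points are geodesics. -/

section GibbonsHawkingOrbit

theorem momentDeriv_coordVec {X : Type*} [TopologicalSpace X] [ChartedSpace R4 X]
    [IsManifold (𝓡 4) ∞ X] {μ : X → R3} (hμ : ContMDiff (𝓡 4) 𝓘(ℝ, R3) ∞ μ) {x₀ : X} {y : R4}
    (hy : y ∈ (extChartAt (𝓡 4) x₀).target) (v : R4) :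
    momentDeriv μ ((extChartAt (𝓡 4) x₀).symm y) (coordVec x₀ y v)
      = fderiv ℝ (μ ∘ (extChartAt (𝓡 4) x₀).symm) y v := by
  have h1 : MDifferentiableAt 𝓘(ℝ, R4) (𝓡 4) (extChartAt (𝓡 4) x₀).symm y :=
    (contMDiffAt_extChartAt_symm hy).mdifferentiableAt (by simp)
  have h2 : MDifferentiableAt (𝓡 4) 𝓘(ℝ, R3) μ ((extChartAt (𝓡 4) x₀).symm y) :=
    hμ.mdifferentiable (by simp) _
  have h3 := (h2.hasMFDerivAt.comp y h1.hasMFDerivAt).mfderiv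
  rw [mfderiv_eq_fderiv] at h3
  exact (congrArg (fun L : R4 →L[ℝ] R3 => L v) h3).symm

variable {X : Type*} [TopologicalSpace X] [ChartedSpace R4 X] [IsManifold (𝓡 4) ∞ X]
  [MulAction Circle X]

theorem smul_mem_freeLocus {X : Type*} [MulAction Circle X] {x : X} (hx : x ∈ freeLocus X)
    (z : Circle) : z • x ∈ freeLocus X := fun w hw => hx w <| by
  have h : z • (w • x) = z • x := by rw [smul_smul, mul_comm z w, ← smul_smul, hw]
  exact MulAction.injective z h

variable {g : Metric4 X} {μ : X → R3} {φ : R3 → ℝ} {Y : Set R3}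

namespace IsGibbonsHawking

theorem moment_smul (hX : IsGibbonsHawking g μ φ Y) {x : X} (hx : x ∈ freeLocus X) (z : Circle) :
    μ (z • x) = μ x :=
  ((hX.fibre_iff x hx _ (smul_mem_freeLocus hx z)).2 ⟨z, rfl⟩).symm

theorem momentDeriv_generator (hX : IsGibbonsHawking g μ φ Y) {x : X} (hx : x ∈ freeLocus X) :
    momentDeriv μ x (circleGenerator x) = 0 := by
  have hγ : MDifferentiableAt 𝓘(ℝ, ℝ) (𝓡 4) (fun t : ℝ => Circle.exp t • x) 0 :=
    (contMDiff_orbit hX.smooth_action x).mdifferentiable (by simp) _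
  have hμ : MDifferentiableAt (𝓡 4) 𝓘(ℝ, R3) μ (Circle.exp 0 • x) :=
    hX.smooth_moment.mdifferentiable (by simp) _
  have h1 := (hμ.hasMFDerivAt.comp (0 : ℝ) hγ.hasMFDerivAt).mfderiv
  have e : μ ∘ (fun t : ℝ => Circle.exp t • x) = fun _ => μ x :=
    funext fun t => hX.moment_smul hx _
  rw [e] at h1
  have h2 := congrArg (fun L : ℝ →L[ℝ] R3 => L 1) h1
  have h3 : mfderiv 𝓘(ℝ, ℝ) 𝓘(ℝ, R3) (fun _ : ℝ => μ x) 0 = 0 := mfderiv_const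
  have h4 : momentDeriv μ (Circle.exp 0 • x) (circleGenerator x : R4) = 0 := by
    refine Eq.trans h2.symm ?_
    exact congrArg (fun L : ℝ →L[ℝ] R3 => L 1) h3
  have key : ∀ (a b : X) (v : R4), a = b → momentDeriv μ a v = momentDeriv μ b v :=
    fun a b v h => by rw [h]
  exact (key _ _ _ (by simp : Circle.exp 0 • x = x)).symm.trans h4

/-- If g(ξ, ξ) = 0, division by zero makes `connForm` vanish identically at x. A nonzero u in the
kernel of dμ, which exists as 4 > 3, would then have g(u, u) = 0 by the ansatz. -/
theorem metric_generator_ne_zero (hX : IsGibbonsHawking g μ φ Y) {x : X} (hx : x ∈ freeLocus X) :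
    g.inner x (circleGenerator x) (circleGenerator x) ≠ 0 := by
  intro h0
  let L : R4 →ₗ[ℝ] R3 := (show R4 →L[ℝ] R3 from mfderiv (𝓡 4) 𝓘(ℝ, R3) μ x).toLinearMap
  have hker : LinearMap.ker L ≠ ⊥ := LinearMap.ker_ne_bot_of_finrank_lt (by simp)
  obtain ⟨u, hu, hu0⟩ := Submodule.exists_mem_ne_zero_of_ne_bot hker
  have hmu : momentDeriv μ x u = 0 := hu
  have h1 := hX.metric_eq x hx u u
  have hc : connForm g x u = 0 :=
    (congrArg (fun d => g.inner x (circleGenerator x) u / d) h0).trans (div_zero _)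
  rw [hc, hmu, inner_zero_left] at h1
  simp only [mul_zero, add_zero] at h1
  exact (g.pos x u hu0).ne' h1

theorem connForm_generator (hX : IsGibbonsHawking g μ φ Y) {x : X} (hx : x ∈ freeLocus X) :
    connForm g x (circleGenerator x) = 1 := div_self (hX.metric_generator_ne_zero hx)

end IsGibbonsHawking

/-- The connection form in the preferred chart around `x₀`. -/
noncomputable def coordConnForm (g : Metric4 X) (x₀ : X) (y : R4) : R4 →L[ℝ] ℝ :=
  (g.inner ((extChartAt (𝓡 4) x₀).symm y) (circleGenerator _) (circleGenerator _))⁻¹ •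
    (g.inner ((extChartAt (𝓡 4) x₀).symm y) (circleGenerator _)).comp
      (mfderiv 𝓘(ℝ, R4) (𝓡 4) (extChartAt (𝓡 4) x₀).symm y)

theorem coordConnForm_apply (g : Metric4 X) (x₀ : X) (y v : R4) :
    coordConnForm g x₀ y v = connForm g ((extChartAt (𝓡 4) x₀).symm y) (coordVec x₀ y v) :=
  (div_eq_inv_mul _ _).symm

/-- Identifies the chart velocity of the orbit with ξ, so that η(ξ) = 1 and dμ(ξ) = 0 become the
coordinate conditions on c'. -/
theorem coordVec_deriv_orbit
    (hA : ContMDiff ((𝓡 1).prod (𝓡 4)) (𝓡 4) ∞ (fun p : Circle × X => p.1 • p.2)) {x x₀ : X} {s : ℝ}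
    (hs : Circle.exp s • x ∈ (extChartAt (𝓡 4) x₀).source) :
    (coordVec x₀ (extChartAt (𝓡 4) x₀ (Circle.exp s • x))
        (deriv (fun s : ℝ => extChartAt (𝓡 4) x₀ (Circle.exp s • x)) s) : R4)
      = circleGenerator ((extChartAt (𝓡 4) x₀).symm (extChartAt (𝓡 4) x₀ (Circle.exp s • x))) := by
  set e := extChartAt (𝓡 4) x₀ with he
  have hγ := contMDiff_orbit hA x
  have hc : MDifferentiableAt 𝓘(ℝ, ℝ) 𝓘(ℝ, R4) (fun s : ℝ => e (Circle.exp s • x)) s :=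
    (ContMDiffAt.comp s (contMDiffAt_extChartAt' (n := ∞) (by simpa [he] using hs))
      hγ.contMDiffAt).mdifferentiableAt (by simp)
  have h1 : MDifferentiableAt 𝓘(ℝ, R4) (𝓡 4) e.symm (e (Circle.exp s • x)) :=
    (contMDiffAt_extChartAt_symm (e.map_source hs)).mdifferentiableAt (by simp)
  have h2 := h1.hasMFDerivAt.comp s hc.hasMFDerivAt
  have hev : (fun s : ℝ => Circle.exp s • x) =ᶠ[𝓝 s]
      e.symm ∘ fun s : ℝ => e (Circle.exp s • x) := by
    filter_upwards [hγ.continuous.continuousAt.eventually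
      ((isOpen_extChartAt_source x₀).mem_nhds hs)] with r hr
    exact (e.left_inv hr).symm
  have h3 := (h2.congr_of_eventuallyEq hev).mfderiv
  have h4 := congrArg (fun L : ℝ →L[ℝ] R4 => L 1) h3
  have h5 : (mfderiv 𝓘(ℝ, ℝ) 𝓘(ℝ, R4) (fun s : ℝ => e (Circle.exp s • x)) s (1 : ℝ) : R4)
      = deriv (fun s : ℝ => e (Circle.exp s • x)) s := by
    rw [mfderiv_eq_fderiv]; rfl
  have key : ∀ a b : X, a = b → (circleGenerator a : R4) = circleGenerator b :=
    fun a b h => by rw [h]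
  refine Eq.trans ?_ ((mfderiv_orbit hA x s).trans (key _ _ (e.left_inv hs).symm))
  refine Eq.trans ?_ h4.symm
  exact congrArg (fun v : R4 => (mfderiv 𝓘(ℝ, R4) (𝓡 4) e.symm (e (Circle.exp s • x)) v : R4))
    h5.symm

namespace IsGibbonsHawking

theorem contDiffAt_coordConnForm (hX : IsGibbonsHawking g μ φ Y) {x₀ : X} {y : R4}
    (hy : y ∈ (extChartAt (𝓡 4) x₀).target)
    (hfree : (extChartAt (𝓡 4) x₀).symm y ∈ freeLocus X) :
    ContDiffAt ℝ ∞ (coordConnForm g x₀) y := by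
  let U : Set R4 := (extChartAt (𝓡 4) x₀).target ∩ (extChartAt (𝓡 4) x₀).symm ⁻¹' freeLocus X
  have hU : IsOpen U :=
    (contMDiffOn_extChartAt_symm (I := 𝓡 4) (n := ∞) x₀).continuousOn.isOpen_inter_preimage
      (isOpen_extChartAt_target x₀) hX.isOpen_free
  have h : ContDiffOn ℝ ∞ (coordConnForm g x₀) U := by
    refine contDiffOn_clm_apply.2 fun v z hz => ContDiffAt.contDiffWithinAt ?_
    have hξ : ContMDiffAt 𝓘(ℝ, R4) (𝓡 4).tangent ∞ (fun y =>
        (⟨(extChartAt (𝓡 4) x₀).symm y, circleGenerator _⟩ : TangentBundle (𝓡 4) X)) z :=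
      ContMDiffAt.comp z (contMDiff_circleGenerator hX.smooth_action).contMDiffAt
        (contMDiffAt_extChartAt_symm hz.1)
    have hv := (contMDiffOn_coordVec x₀ v).contMDiffAt ((isOpen_extChartAt_target x₀).mem_nhds hz.1)
    simp only [coordConnForm_apply, connForm]
    exact (contDiffAt_metric_apply g hξ hv).div (contDiffAt_metric_apply g hξ hξ)
      (hX.metric_generator_ne_zero hz.2)
  exact h.contDiffAt (hU.mem_nhds ⟨hy, hfree⟩)

/-- A free circle orbit lying over a critical point of the potential is a geodesic. -/
theorem isGeodesic_orbit (hX : IsGibbonsHawking g μ φ Y) {x : X} (hx : x ∈ freeLocus X)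
    (hcrit : fderiv ℝ φ (μ x) = 0) : IsGeodesic g (fun t : ℝ => Circle.exp t • x) := by
  have hγ := contMDiff_orbit hX.smooth_action x
  refine ⟨hγ, fun x₀ t ht => ?_⟩
  intro c v
  set e := extChartAt (𝓡 4) x₀ with he
  have hct : c t ∈ e.target := e.map_source ht
  have hsymm : e.symm (c t) = Circle.exp t • x := e.left_inv ht
  have hfree : e.symm (c t) ∈ freeLocus X := hsymm ▸ smul_mem_freeLocus hx _
  have hY : μ x ∈ Y := (hX.free_iff x).1 hx
  have hφ0 : φ (μ x) ≠ 0 := (hX.pos _ hY).ne'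
  have hsrc : ∀ᶠ s in 𝓝 t, Circle.exp s • x ∈ e.source :=
    hγ.continuous.continuousAt.eventually ((isOpen_extChartAt_source x₀).mem_nhds ht)
  have hU : ∀ᶠ y in 𝓝 (c t), y ∈ e.target ∧ e.symm y ∈ freeLocus X := by
    have ho : IsOpen (e.target ∩ e.symm ⁻¹' freeLocus X) :=
      (contMDiffOn_extChartAt_symm (I := 𝓡 4) (n := ∞) x₀).continuousOn.isOpen_inter_preimage
        (isOpen_extChartAt_target x₀) hX.isOpen_free
    exact ho.mem_nhds ⟨hct, hfree⟩
  let m : R4 → R3 := μ ∘ e.symm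
  have hm : ContDiffAt ℝ ∞ m (c t) :=
    (ContMDiffAt.comp (c t) hX.smooth_moment.contMDiffAt
      (contMDiffAt_extChartAt_symm hct)).contDiffAt
  have hmt : m (c t) = μ x := by
    simp only [m, Function.comp_apply, hsymm, hX.moment_smul hx]
  -- The whole orbit lies over the critical point μ x, so φ ∘ m and its inverse are critical at
  -- every c t.
  have hφd : HasFDerivAt φ (0 : R3 →L[ℝ] ℝ) (m (c t)) := by
    rw [hmt, ← hcrit]
    exact ((hX.harmonic _ hY).1.differentiableAt (by norm_num)).hasFDerivAt
  have hP : HasFDerivAt (fun y => φ (m y)) (0 : R4 →L[ℝ] ℝ) (c t) := by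
    have := hφd.comp (c t) (hm.differentiableAt (by simp)).hasFDerivAt
    rwa [ContinuousLinearMap.zero_comp] at this
  have hf : HasFDerivAt (fun y => (φ (m y))⁻¹) (0 : R4 →L[ℝ] ℝ) (c t) := by
    have := (hasDerivAt_inv (hmt ▸ hφ0 : φ (m (c t)) ≠ 0)).comp_hasFDerivAt (c t) hP
    rwa [smul_zero] at this
  have hα := (hX.contDiffAt_coordConnForm hct hfree).differentiableAt (by simp)
  have hc : ContDiffAt ℝ ∞ c t :=
    (ContMDiffAt.comp t (contMDiffAt_extChartAt' (n := ∞) (by simpa [he] using ht))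
      hγ.contMDiffAt).contDiffAt
  have hG : ∀ᶠ y in 𝓝 (c t), ∀ u v, coordMetric g x₀ y u v
      = (φ (m y))⁻¹ * (coordConnForm g x₀ y u * coordConnForm g x₀ y v)
        + φ (m y) * inner ℝ (fderiv ℝ m y u) (fderiv ℝ m y v) := by
    filter_upwards [hU] with y hy u v
    rw [coordMetric, hX.metric_eq _ hy.2, coordConnForm_apply, coordConnForm_apply,
      momentDeriv_coordVec hX.smooth_moment hy.1, momentDeriv_coordVec hX.smooth_moment hy.1]
    rfl
  have hαc : ∀ᶠ s in 𝓝 t, coordConnForm g x₀ (c s) (deriv c s) = 1 := by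
    filter_upwards [hsrc] with s hs
    have hfree' : e.symm (c s) ∈ freeLocus X := by
      rw [show e.symm (c s) = Circle.exp s • x from e.left_inv hs]
      exact smul_mem_freeLocus hx _
    rw [coordConnForm_apply]
    exact (congrArg (connForm g (e.symm (c s))) (coordVec_deriv_orbit hX.smooth_action hs)).trans
      (hX.connForm_generator hfree')
  have hmc : ∀ᶠ s in 𝓝 t, fderiv ℝ m (c s) (deriv c s) = 0 := by
    filter_upwards [hsrc] with s hs
    have hfree' : e.symm (c s) ∈ freeLocus X := by
      rw [show e.symm (c s) = Circle.exp s • x from e.left_inv hs]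
      exact smul_mem_freeLocus hx _
    rw [← momentDeriv_coordVec hX.smooth_moment (e.map_source hs)]
    exact (congrArg (momentDeriv μ (e.symm (c s))) (coordVec_deriv_orbit hX.smooth_action hs)).trans
      (hX.momentDeriv_generator hfree')
  have hcurv : ∀ v, fderiv ℝ (coordConnForm g x₀) (c t) (deriv c t) v
      = fderiv ℝ (coordConnForm g x₀) (c t) v (deriv c t) := by
    intro v
    have hd : ∀ u w, fderiv ℝ (fun z => connForm g (e.symm z) (coordVec x₀ z w)) (c t) u
        = fderiv ℝ (coordConnForm g x₀) (c t) u w := fun u w => by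
      have := (hα.hasFDerivAt.clm_apply (hasFDerivAt_const w (c t))).fderiv
      simp only [coordConnForm_apply] at this
      rw [this]
      simp
    -- The monopole equation at a critical point reads dη = 0, which is the symmetry of Dα required
    -- here.
    have hmon := hX.monopole x₀ (c t) hct hfree (deriv c t) v
    have hzero : fderiv ℝ φ (μ (e.symm (c t))) = 0 := by
      rw [show μ (e.symm (c t)) = μ x from hmt, hcrit]
    rw [coordCurvature, hd, hd, hzero, hodgeStar] at hmon
    simpa [sub_eq_zero] using hmon
  exact geodesic_equation_of_fibration hG hf hP hα (hm.of_le (by norm_cast))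
    (hc.of_le (by norm_cast)) hαc hmc hcurv v

end IsGibbonsHawking

theorem circleExp_pi_ne_one : Circle.exp Real.pi ≠ 1 := by
  intro h
  have := congrArg (fun z : Circle => (z : ℂ)) h
  simp [Circle.coe_exp, Complex.exp_pi_mul_I] at this
  norm_num at this

end GibbonsHawkingOrbit

/-- A connected Gibbons–Hawking manifold whose harmonic function `φ` on `ℝ³` has a finite number
`k ≥ 2` of isolated singularities (the points of `S`) contains a closed geodesic, and there is one
which is an orbit of the circle action. -/
theorem proposition3p2 {X : Type*} [TopologicalSpace X] [T2Space X] [SecondCountableTopology X]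
    [ConnectedSpace X] [ChartedSpace R4 X] [IsManifold (𝓡 4) ∞ X] [MulAction Circle X]
    (g : Metric4 X) (μ : X → R3) (φ : R3 → ℝ) (S : Finset R3)
    (hX : IsGibbonsHawking g μ φ (↑S : Set R3)ᶜ)
    (hS : ∀ p ∈ S, HasIsolatedSingularityAt φ p) (hk : 2 ≤ S.card) :
    ∃ γ : ℝ → X, IsClosedGeodesic g γ ∧
      ∃ x ∈ freeLocus X, γ = fun t : ℝ => Circle.exp t • x := by
  obtain ⟨q, hq, hq0⟩ := exists_fderiv_eq_zero_of_isolatedSingularities hX.harmonic hX.pos hS hk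
  obtain ⟨x, rfl⟩ := hX.surj q hq
  have hx : x ∈ freeLocus X := (hX.free_iff x).2 hq
  -- The orbit has period 2π; it is not constant because the half turn e^{iπ} ≠ 1 cannot fix a point
  -- with trivial stabilizer.
  refine ⟨fun t => Circle.exp t • x, ⟨hX.isGeodesic_orbit hx hq0, ⟨2 * Real.pi, by positivity,
    fun t => ?_⟩, Real.pi, fun h => circleExp_pi_ne_one (hx _ ?_)⟩, x, hx, rfl⟩
  · simp only [Circle.periodic_exp t]
  · simpa using h
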